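/- **Setting.** Let $\nu_X,\nu_Y$ be $\sigma$-finite measures on measurable spaces $\Omega_X,\Omega_Y$. Let $y_0,\dots,y_K\in\Omega_Y$ be distinct and let $x^\circ\in\Omega_X$ and $y^\circ=y_0$ be the reference values. Let $h_X:\Omega_X\to\mathbb R^{d_X}$ and $h_Y:\Omega_Y\to\mathbb R^{d_Y}$ be measurable with $h_X(x^\circ)=0$, $h_Y(y_0)=0$. For $\theta\in\mathbb R^S$ let $\psi_\theta(x,y)=G(h_X(x),h_Y(y),\theta)$ be measurable in $(x,y)$, where $G(0,\cdot,\cdot)=G(\cdot,0,\cdot)=0$ and, for $z\in h_X[\Omega_X]$, $v\in h_Y[\Omega_Y]$, $G(z,v,\theta)$ is three times continuously differentiable in $\theta$ with derivatives of orders 1, 2, 3 that are continuous in $z$ and in $v$. Let $(X,Y)$ have a positive measurable density $p(x,y)$ with respect to $\nu_X\times\nu_Y$ such that, for some $\theta^\circ\in\mathbb R^S$ and all $x,y$, $$\log\frac{p(x,y)\,p(x^\circ,y_0)}{p(x,y_0)\,p(x^\circ,y)}=\psi_{\theta^\circ}(x,y),$$ and suppose $\int p(x,y_k)\,d\nu_X(x)<\infty$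 for all $k$. Write $p(x\mid y_k)=p(x,y_k)/\int p(x',y_k)\,d\nu_X(x')$, and let $X_k$ have $\nu_X$-density $p(\cdot\mid y_k)$. **Sampling conditional on $Y$.** Let $X_{ki}$ ($0\le k\le K$, $i\ge1$) be independent with $X_{ki}\sim X_k$. Along a sequence of total sample sizes $n=\sum_k n_k\to\infty$, with fixed ratios $n_k/n=\bar r_k>0$, the sample is $(X_{ki})_{0\le k\le K,\,1\le i\le n_k}$. For $\lambda=(\theta,\gamma)\in\mathbb R^{S+K}$, with $\gamma_0:=0$, put $$p_k^*(x\mid\lambda)=\frac{\exp[\gamma_k+\psi_\theta(x,y_k)]}{\sum_{l=0}^K\exp[\gamma_l+\psi_\theta(x,y_l)]},\qquad \ell^{(n)}(\lambda)=\sum_{k=0}^K\sum_{i=1}^{n_k}\log p_k^*(X_{ki}\mid\lambda),$$ $$\mathbf J^{(n)}(\lambda)=-D^2_{\lambda\lambda}\ell^{(n)}(\lambda),\qquad \bar{\mathbf I}(\lambda)=\sum_{k=0}^K\bar r_k\,E\bigl(-D^2_{\lambda\lambda}\log p_k^*(X_k\mid\lambda)\bigr).$$ The true parameter is $\lambda^\circ=(\theta^\circ,\gamma^\circ)$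 with $\gamma_k^\circ=\log\dfrac{\bar r_k\,p(x^\circ\mid y_k)}{\bar r_0\,p(x^\circ\mid y_0)}$, $k=1,\dots,K$. Assume that for each $k$ the components of $D_\lambda\log p^*_k(X_k\mid\lambda^\circ)$ are square-integrable, that the entries of $D^2_{\lambda\lambda}\log p^*_k(X_k\mid\lambda^\circ)$ are integrable, and that $\bar{\mathbf I}(\lambda^\circ)$ is positive definite. Let $\hat\lambda^{(n)}=(\hat\theta^{(n)},\hat\gamma^{(n)})$ be measurable estimators such that, as $n\to\infty$, * (N1) $n^{-1/2}D_\lambda\ell^{(n)}(\hat\lambda^{(n)})\to 0$ in probability; * (N2) $\hat\lambda^{(n)}\to\lambda^\circ$ in probability; * (N3) $\frac1n\int_0^1\mathbf J^{(n)}\bigl(\lambda^\circ+t[\hat\lambda^{(n)}-\lambda^\circ]\bigr)\,dt\to\bar{\mathbf I}(\lambda^\circ)$ in probability; * (N4) $\frac1n\mathbf J^{(n)}(\hat\lambda^{(n)})\to\bar{\mathbf I}(\lambda^\circ)$ in probability. **Corollary.** Let $\mathbf A^{-}$ denote the Moore–Penrose inverse of a symmetric matrix, $\mathbf A^{1/2}$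 the symmetric root of a positive semidefinite matrix (for other symmetric matrices, which occur here only with probability tending to $0$, the root of the positive part), $\mathbf A^{-1/2}=(\mathbf A^{1/2})^-$, and $[\,\cdot\,]_{\theta\theta}$ the $S\times S$ block belonging to $\theta$. Then $$\Bigl(\bigl[\mathbf J^{(n)}(\hat\lambda^{(n)})^{-}\bigr]_{\theta\theta}\Bigr)^{-1/2}\bigl[\hat\theta^{(n)}-\theta^\circ\bigr]\ \xrightarrow[n\to\infty]{\mathcal L}\ N(0,\mathbb I).$$ Moreover, for every sample, the estimated asymptotic covariance matrix $[\mathbf J^{(n)}(\hat\lambda^{(n)})^{-}]_{\theta\theta}$ of $\hat\theta^{(n)}$ is identical to the corresponding matrix under sampling conditional on $X$. The latter is the $\theta\theta$-block of the Moore–Penrose inverse of the observed information at $\hat\lambda^{(n)}$ computed from the log-likelihood of independent observations of $Y$ at the given values $X_{ki}$, where $Y$ takes the value $y_l$ at $x$ with probability $p^*_l(x\mid\lambda)$, $l=0,\dots,K$, and $y_k$ has been observed at $X_{ki}$. -/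

import Mathlib

open MeasureTheory ProbabilityTheory Filter
open scoped Topology ENNReal Matrix

noncomputable section

/-! ### Derivatives and symmetric matrices -/

/-- Partial derivative of `f : ℝ^ι → ℝ` in the coordinate `s` at the point `u`. -/
def partialD {ι : Type*} [Fintype ι] [DecidableEq ι] (f : EuclideanSpace ℝ ι → ℝ) (s : ι)
    (u : EuclideanSpace ℝ ι) : ℝ :=
  fderiv ℝ f u (EuclideanSpace.single s 1)

/-- The vector of first partial derivatives. -/
def scoreVec {ι : Type*} [Fintype ι] [DecidableEq ι] (f : EuclideanSpace ℝ ι → ℝ)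
    (u : EuclideanSpace ℝ ι) : EuclideanSpace ℝ ι :=
  WithLp.toLp 2 fun s => partialD f s u

/-- The matrix of second partial derivatives. -/
def hessianMat {ι : Type*} [Fintype ι] [DecidableEq ι] (f : EuclideanSpace ℝ ι → ℝ)
    (u : EuclideanSpace ℝ ι) : Matrix ι ι ℝ :=
  Matrix.of fun s t => partialD (fun w => partialD f t w) s u

/-- The Moore–Penrose inverse of a symmetric real matrix: in an orthonormal eigenbasis every
nonzero eigenvalue is inverted and zero eigenvalues are kept (in Lean `0⁻¹ = 0`). -/
def symPinv {ι : Type*} [Fintype ι] [DecidableEq ι] (A : Matrix ι ι ℝ) : Matrix ι ι ℝ :=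
  cfc (fun x : ℝ => x⁻¹) A

/-- The symmetric square root of a positive semidefinite real matrix. -/
def symRoot {ι : Type*} [Fintype ι] [DecidableEq ι] (A : Matrix ι ι ℝ) : Matrix ι ι ℝ :=
  cfc Real.sqrt A

/-- `symPinv A` satisfies the four Penrose equations, so it is the Moore–Penrose inverse. -/
theorem symPinv_penrose {ι : Type*} [Fintype ι] [DecidableEq ι] {A : Matrix ι ι ℝ}
    (hA : A.IsHermitian) :
    A * symPinv A * A = A ∧ symPinv A * A * symPinv A = symPinv A ∧
      (A * symPinv A)ᵀ = A * symPinv A ∧ (symPinv A * A)ᵀ = symPinv A * A := by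
  have hs : IsSelfAdjoint A := hA
  have hc : ∀ f : ℝ → ℝ, ContinuousOn f (spectrum ℝ A) := fun f => by
    rw [continuousOn_iff_continuous_domRestrict]; fun_prop
  have e1 : A * symPinv A = cfc (fun x : ℝ => x * x⁻¹) A := by
    conv_lhs => rw [symPinv]; lhs; rw [← cfc_id' ℝ A hs]
    rw [← cfc_mul _ _ A (hc _) (hc _)]
  have e2 : symPinv A * A = cfc (fun x : ℝ => x⁻¹ * x) A := by
    conv_lhs => rw [symPinv]; rhs; rw [← cfc_id' ℝ A hs]
    rw [← cfc_mul _ _ A (hc _) (hc _)]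
  have hsym : ∀ f : ℝ → ℝ, (cfc f A)ᵀ = cfc f A := fun f => by
    have h : IsSelfAdjoint (cfc f A) := cfc_predicate f A
    have h' : (cfc f A)ᴴ = cfc f A := h
    rwa [Matrix.conjTranspose_eq_transpose_of_trivial] at h'
  refine ⟨?_, ?_, by rw [e1, hsym], by rw [e2, hsym]⟩
  · rw [e1]
    conv_lhs => rhs; rw [← cfc_id' ℝ A hs]
    rw [← cfc_mul _ _ A (hc _) (hc _)]
    conv_rhs => rw [← cfc_id' ℝ A hs]
    refine cfc_congr fun x _ => ?_
    by_cases hx : x = 0 <;> simp [hx]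
  · rw [e2, symPinv, ← cfc_mul _ _ A (hc _) (hc _)]
    refine cfc_congr fun x _ => ?_
    by_cases hx : x = 0 <;> simp [hx]

theorem symRoot_mul_self {ι : Type*} [Fintype ι] [DecidableEq ι] {A : Matrix ι ι ℝ}
    (hA : A.PosSemidef) : (symRoot A).IsHermitian ∧ symRoot A * symRoot A = A := by
  have hs : IsSelfAdjoint A := hA.isHermitian
  have hc : ∀ f : ℝ → ℝ, ContinuousOn f (spectrum ℝ A) := fun f => by
    rw [continuousOn_iff_continuous_domRestrict]; fun_prop
  refine ⟨cfc_predicate Real.sqrt A, ?_⟩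
  rw [symRoot, ← cfc_mul _ _ A (hc _) (hc _)]
  conv_rhs => rw [← cfc_id' ℝ A hs]
  refine cfc_congr fun x hx => ?_
  have h := hA.isHermitian.spectrum_real_eq_range_eigenvalues ▸ hx
  obtain ⟨i, rfl⟩ := h
  exact Real.mul_self_sqrt (hA.eigenvalues_nonneg i)

/-! ### The association model -/

/-- The parameter vectors `(θ, γ)` with `θ ∈ ℝ^S` and `γ = (γ₁, …, γ_K) ∈ ℝ^K`. -/
abbrev Param (S K : ℕ) : Type := EuclideanSpace ℝ (Fin S ⊕ Fin K)

/-- The compound parameter vector built from `θ` and `γ`. -/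
def Param.mk {S K : ℕ} (θ : EuclideanSpace ℝ (Fin S)) (γ : Fin K → ℝ) : Param S K :=
  WithLp.toLp 2 (Sum.elim (fun s => θ s) γ)

/-- The component `θ` of `(θ, γ)`. -/
def Param.theta {S K : ℕ} (u : Param S K) : EuclideanSpace ℝ (Fin S) :=
  WithLp.toLp 2 fun s => u (Sum.inl s)

/-- The nuisance parameter `γ_k`, `k = 0, …, K`, with the convention `γ₀ = 0`. -/
def Param.gamma {S K : ℕ} (u : Param S K) : Fin (K + 1) → ℝ :=
  Fin.cons 0 fun k => u (Sum.inr k)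

/-- An odds ratio model `log OR(x, y) = G (h_X x, h_Y y, θ)` together with the values
`y₀, …, y_K` of `Y` to be conditioned upon; the reference values are `x₀` and `y₀ = y 0`. -/
structure AssociationModel (ΩX ΩY : Type*) [MeasurableSpace ΩX] [MeasurableSpace ΩY]
    (dX dY S K : ℕ) where
  hX : ΩX → EuclideanSpace ℝ (Fin dX)
  hY : ΩY → EuclideanSpace ℝ (Fin dY)
  G : EuclideanSpace ℝ (Fin dX) → EuclideanSpace ℝ (Fin dY) → EuclideanSpace ℝ (Fin S) → ℝ
  x₀ : ΩX
  y : Fin (K + 1) → ΩY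
  y_injective : Function.Injective y
  measurable_hX : Measurable hX
  measurable_hY : Measurable hY
  hX_ref : hX x₀ = 0
  hY_ref : hY (y 0) = 0
  G_zero_left : ∀ v θ, G 0 v θ = 0
  G_zero_right : ∀ z θ, G z 0 θ = 0
  measurable_logOR : ∀ θ, Measurable fun q : ΩX × ΩY => G (hX q.1) (hY q.2) θ
  /-- `G` is three times continuously differentiable in `θ` … -/
  contDiff_G : ∀ x y, ContDiff ℝ 3 (G (hX x) (hY y))
  /-- … and its derivatives in `θ` are continuous in `z ∈ h_X[Ω_X]` and in `v ∈ h_Y[Ω_Y]`. -/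
  continuousOn_deriv_left : ∀ j ∈ Finset.Icc 1 3, ∀ y θ,
    ContinuousOn (fun z => iteratedFDeriv ℝ j (G z (hY y)) θ) (Set.range hX)
  continuousOn_deriv_right : ∀ j ∈ Finset.Icc 1 3, ∀ x θ,
    ContinuousOn (fun v => iteratedFDeriv ℝ j (G (hX x) v) θ) (Set.range hY)

namespace AssociationModel

variable {ΩX ΩY : Type*} [MeasurableSpace ΩX] [MeasurableSpace ΩY] {dX dY S K : ℕ}

/-- The log-odds ratio function `ψ_θ(x, y)` of the model. -/
def logOR (M : AssociationModel ΩX ΩY dX dY S K) (θ : EuclideanSpace ℝ (Fin S))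
    (x : ΩX) (y : ΩY) : ℝ :=
  M.G (M.hX x) (M.hY y) θ

/-- The modelled conditional probability of `y_k` given `x`,
`exp (γ_k + ψ_θ(x, y_k)) / ∑_l exp (γ_l + ψ_θ(x, y_l))`. -/
def prob (M : AssociationModel ΩX ΩY dX dY S K) (k : Fin (K + 1)) (x : ΩX) (u : Param S K) : ℝ :=
  Real.exp (u.gamma k + M.logOR u.theta x (M.y k)) /
    ∑ l, Real.exp (u.gamma l + M.logOR u.theta x (M.y l))

/-- Its logarithm as a function of the parameter. -/
def logProb (M : AssociationModel ΩX ΩY dX dY S K) (k : Fin (K + 1)) (x : ΩX)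
    (u : Param S K) : ℝ :=
  Real.log (M.prob k x u)

/-- The function `ℓ(u) = ∑_k ∑_{i ≤ n_k} log p*_k(x_{ki})` for the observed values `x_{ki}`
with sample sizes `n_k = N k`. -/
def logLik (M : AssociationModel ΩX ΩY dX dY S K) (N : Fin (K + 1) → ℕ)
    (x : Fin (K + 1) → ℕ → ΩX) (u : Param S K) : ℝ :=
  ∑ k, ∑ i ∈ Finset.range (N k), M.logProb k (x k i) u

/-- The observed information `J(u)`, the negative matrix of second derivatives of `ℓ`. -/
def obsInfo (M : AssociationModel ΩX ΩY dX dY S K) (N : Fin (K + 1) → ℕ)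
    (x : Fin (K + 1) → ℕ → ΩX) (u : Param S K) : Matrix (Fin S ⊕ Fin K) (Fin S ⊕ Fin K) ℝ :=
  -hessianMat (M.logLik N x) u

/-! ### Sampling conditional on `Y` -/

/-- `p` is a positive density, with respect to `νX × νY`, of a joint distribution of `(X, Y)`
whose log-odds ratio function with respect to the reference values `x₀`, `y₀` is `ψ_θ`, and
the marginal density of `Y` is finite at `y₀, …, y_K`. -/
structure IsJointDensity (M : AssociationModel ΩX ΩY dX dY S K) (νX : Measure ΩX)
    (νY : Measure ΩY) (θ : EuclideanSpace ℝ (Fin S)) (p : ΩX → ΩY → ℝ) : Prop where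
  pos : ∀ x y, 0 < p x y
  measurable : Measurable fun q : ΩX × ΩY => p q.1 q.2
  lintegral_eq_one : ∫⁻ q, ENNReal.ofReal (p q.1 q.2) ∂(νX.prod νY) = 1
  log_oddsRatio : ∀ x y,
    Real.log (p x y * p M.x₀ (M.y 0) / (p x (M.y 0) * p M.x₀ y)) = M.logOR θ x y
  integrable_slice : ∀ k, Integrable (fun x => p x (M.y k)) νX

/-- The conditional density `p(x | Y = y_k)` with respect to `νX`. -/
def condDensity (M : AssociationModel ΩX ΩY dX dY S K) (νX : Measure ΩX) (p : ΩX → ΩY → ℝ)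
    (k : Fin (K + 1)) (x : ΩX) : ℝ :=
  p x (M.y k) / ∫ x', p x' (M.y k) ∂νX

/-- The conditional distribution of `X` given `Y = y_k`. -/
def condLaw (M : AssociationModel ΩX ΩY dX dY S K) (νX : Measure ΩX) (p : ΩX → ΩY → ℝ)
    (k : Fin (K + 1)) : Measure ΩX :=
  νX.withDensity fun x => ENNReal.ofReal (M.condDensity νX p k x)

/-- The conditional probability of `y_k` given `X = x` after the marginal distribution of `Y` has
been replaced by the distribution on `{y₀, …, y_K}` with weights `r k`. -/
def reverseProb (M : AssociationModel ΩX ΩY dX dY S K) (νX : Measure ΩX) (p : ΩX → ΩY → ℝ)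
    (r : Fin (K + 1) → ℝ) (k : Fin (K + 1)) (x : ΩX) : ℝ :=
  r k * M.condDensity νX p k x / ∑ l, r l * M.condDensity νX p l x

/-- The true parameter `(θ, γ)`. As `ψ_θ(x₀, ·) = 0`, the nuisance parameter `γ_k` is the log-ratio
of the conditional probabilities of `y_k` and `y₀` given `X = x₀`. -/
def trueParam (M : AssociationModel ΩX ΩY dX dY S K) (νX : Measure ΩX) (p : ΩX → ΩY → ℝ)
    (r : Fin (K + 1) → ℝ) (θ : EuclideanSpace ℝ (Fin S)) : Param S K :=
  Param.mk θ fun k =>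
    Real.log (M.reverseProb νX p r k.succ M.x₀ / M.reverseProb νX p r 0 M.x₀)

/-- The limiting information
`Ī(u) = ∑_k r_k E(-D²_u log p*_k(X_k))`, where `X_k` has the law of `X` given `Y = y_k`. -/
def limitInfo (M : AssociationModel ΩX ΩY dX dY S K) (νX : Measure ΩX) (p : ΩX → ΩY → ℝ)
    (r : Fin (K + 1) → ℝ) (u : Param S K) : Matrix (Fin S ⊕ Fin K) (Fin S ⊕ Fin K) ℝ :=
  Matrix.of fun s t => ∑ k, r k * ∫ x, -hessianMat (M.logProb k x) u s t ∂(M.condLaw νX p k)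

/-! ### Sampling conditional on `X` -/

/-- The conditional law of the label `k` of `Y = y_k` given `X = x`. -/
def labelLaw (M : AssociationModel ΩX ΩY dX dY S K) (x : ΩX) (u : Param S K) :
    Measure (Fin (K + 1)) :=
  ∑ k, ENNReal.ofReal (M.prob k x u) • Measure.dirac k

/-- The joint law of independent labels for given design points `x j`. -/
def labelsLaw (M : AssociationModel ΩX ΩY dX dY S K) {ι : Type*} [Fintype ι] (x : ι → ΩX)
    (u : Param S K) : Measure (ι → Fin (K + 1)) :=
  Measure.pi fun j => M.labelLaw (x j) u

/-- The observed information under sampling conditional on `X`, for the data consisting of the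
design points `x_{ki}`, `i ≤ n_k`, where the value `y_k` has been observed at each `x_{ki}`: the
negative matrix of second derivatives of the logarithm of the probability of the observed labels. -/
def obsInfoGivenX (M : AssociationModel ΩX ΩY dX dY S K) (N : Fin (K + 1) → ℕ)
    (x : Fin (K + 1) → ℕ → ΩX) (u : Param S K) : Matrix (Fin S ⊕ Fin K) (Fin S ⊕ Fin K) ℝ :=
  -hessianMat (fun w => Real.log
    ((M.labelsLaw (fun j : (Σ k, Fin (N k)) => x j.1 j.2) w).real {fun j => j.1})) u

end AssociationModel

/-- The estimated asymptotic covariance matrix of `θ̂` for the observed information `J`: the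
`θθ`-block of the Moore–Penrose inverse of `J`. -/
def estCov {S K : ℕ} (J : Matrix (Fin S ⊕ Fin K) (Fin S ⊕ Fin K) ℝ) :
    Matrix (Fin S) (Fin S) ℝ :=
  (symPinv J).toBlocks₁₁

end

/-!
The standardized estimator is asymptotically normal because the usual expansion of the score applies
under sampling conditional on `Y`, and because the failure of the equality between the limiting
information `I` and the limiting covariance `V` of the score does not affect the parameter `θ`.

*Expansion.* Integrating the second derivatives of the log-likelihood over the segment between the
true parameter and the estimate (`scoreVec_logLik_sub`) shows that the normalized score at the true
parameter minus the one at the estimate is `B √n (λ̂ - λ)`, where `B` is the averaged information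
divided by `n`. The score at the estimate is negligible and `B → I` in probability, so that
`√n (λ̂ - λ)` behaves like `I⁻¹` times the normalized score at the true parameter. The latter is a sum
over independent strata, one for each `y_k`, and converges to `N(0, V)` by
`tendstoInDistribution_stratified_sum`, with `V` the weighted average of the covariance matrices
within the strata. The means of the scores within the strata need not vanish, but their weighted
average does, since by Bayes' formula (`mul_condDensity_eq`) the modelled probabilities are the
conditional probabilities of the labels in the mixture of the strata.

*Sandwich covariance.* The same formula yields the information identity for `I` and shows that the
column of `I` belonging to `γ_l` is the weighted mean score in the stratum `l` (`limitInfo_inr`). Thus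
`I⁻¹` maps every mean score into the space of the nuisance parameters. As `V` is `I` minus the
weighted sum of the outer products of the mean scores, `I⁻¹ V I⁻¹` and `I⁻¹` have the same
`θθ`-block (`toBlocks₁₁_sandwich`).

*Standardization.* On symmetric matrices `J ↦ ([J⁻]_θθ)^{-1/2}` is continuous at positive definite
matrices, and it is measurable everywhere, as the functional calculus of a symmetric matrix is
continuous for continuous functions. Convergence in probability to a constant is expressed as
convergence along the filter `inProb`; Slutsky's theorem for random matrices
(`tendstoInDistribution_mulVec`) then gives the limit `N(0, 1)`.

*Sampling conditional on `X`.* The probability of the observed labels at the given design points is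
the product of the modelled probabilities, so both sampling schemes have the same log-likelihood and
the same observed information (`obsInfoGivenX_eq_obsInfo`).
-/

noncomputable section

/-! ### Functional calculus of symmetric matrices: measurability and continuity -/

section SymmetricMatrix

variable {ι : Type*} [Fintype ι] [DecidableEq ι]

theorem continuousOn_spectrum_matrix (A : Matrix ι ι ℝ) (f : ℝ → ℝ) :
    ContinuousOn f (spectrum ℝ A) := by
  rw [continuousOn_iff_continuous_domRestrict]; fun_prop

theorem cfc_apply_eq_sum {A : Matrix ι ι ℝ} (hA : A.IsHermitian) (f : ℝ → ℝ) (i j : ι) :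
    cfc f A i j = ∑ k, (hA.eigenvectorUnitary : Matrix ι ι ℝ) i k * f (hA.eigenvalues k) *
      (hA.eigenvectorUnitary : Matrix ι ι ℝ) j k := by
  rw [hA.cfc_eq, Matrix.IsHermitian.cfc, Unitary.conjStarAlgAut_apply, Matrix.mul_apply]
  simp [Matrix.mul_apply, Matrix.diagonal_apply, Matrix.star_apply]

theorem abs_eigenvectorUnitary_le_one {A : Matrix ι ι ℝ} (hA : A.IsHermitian) (i j : ι) :
    |(hA.eigenvectorUnitary : Matrix ι ι ℝ) i j| ≤ 1 := by
  simpa using entry_norm_bound_of_unitary hA.eigenvectorUnitary.2 i j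

theorem abs_eigenvalues_le {A : Matrix ι ι ℝ} (hA : A.IsHermitian) (k : ι) :
    |hA.eigenvalues k| ≤ ∑ i, ∑ j, |A i j| := by
  set U := (hA.eigenvectorUnitary : Matrix ι ι ℝ)
  have h : hA.eigenvalues k = ∑ i, ∑ j, U i k * A i j * U j k := by
    rw [hA.eigenvalues_eq]
    simp only [dotProduct, Matrix.mulVec, Finset.mul_sum, Pi.star_apply, star_trivial]
    simp [U, Matrix.IsHermitian.eigenvectorUnitary_apply, mul_assoc]
  rw [h]
  refine (Finset.abs_sum_le_sum_abs _ _).trans (Finset.sum_le_sum fun i _ => ?_)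
  refine (Finset.abs_sum_le_sum_abs _ _).trans (Finset.sum_le_sum fun j _ => ?_)
  rw [abs_mul, abs_mul]
  have h1 : |U i k| ≤ 1 := abs_eigenvectorUnitary_le_one hA i k
  have h2 : |U j k| ≤ 1 := abs_eigenvectorUnitary_le_one hA j k
  calc |U i k| * |A i j| * |U j k| ≤ 1 * |A i j| * 1 := by gcongr
    _ = |A i j| := by ring

/-- For a continuous function the functional calculus is continuous on the symmetric matrices:
on a neighbourhood with bounded eigenvalues it is uniformly close to that of a polynomial. -/
theorem continuousOn_cfc_isHermitian {f : ℝ → ℝ} (hf : Continuous f) :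
    ContinuousOn (fun A : Matrix ι ι ℝ => cfc f A) {A | A.IsHermitian} := by
  refine continuousOn_pi.2 fun i => continuousOn_pi.2 fun j => ?_
  intro A₀ hA₀
  rw [ContinuousWithinAt, Metric.tendsto_nhds]
  intro ε hε
  set R : ℝ := (∑ i, ∑ j, |A₀ i j|) + 1 with hR
  set c : ℝ := Fintype.card ι + 1 with hc
  have hcpos : 0 < c := by positivity
  obtain ⟨q, hq⟩ := exists_polynomial_near_of_continuousOn (-R) R f hf.continuousOn (ε / (3 * c))
    (by positivity)
  -- the polynomial functional calculus is uniformly close where the eigenvalues lie in `[-R, R]`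
  have key : ∀ A : Matrix ι ι ℝ, A.IsHermitian → (∑ i, ∑ j, |A i j|) < R →
      |cfc f A i j - (Polynomial.aeval A q) i j| ≤ ε / 3 := by
    intro A hA hAR
    have e1 := cfc_apply_eq_sum hA f i j
    have e2 := cfc_apply_eq_sum hA (fun x => q.eval x) i j
    have e3 : cfc (fun x => q.eval x) A = Polynomial.aeval A q := cfc_polynomial q A hA
    rw [← congrFun (congrFun e3 i) j, e1, e2, ← Finset.sum_sub_distrib]
    refine (Finset.abs_sum_le_sum_abs _ _).trans ?_
    have : ∀ k ∈ Finset.univ, |(hA.eigenvectorUnitary : Matrix ι ι ℝ) i k * f (hA.eigenvalues k) *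
        (hA.eigenvectorUnitary : Matrix ι ι ℝ) j k -
        (hA.eigenvectorUnitary : Matrix ι ι ℝ) i k * q.eval (hA.eigenvalues k) *
        (hA.eigenvectorUnitary : Matrix ι ι ℝ) j k| ≤ ε / (3 * c) := by
      intro k _
      have h1 := abs_eigenvectorUnitary_le_one hA i k
      have h2 := abs_eigenvectorUnitary_le_one hA j k
      have h3 := abs_le.1 ((abs_eigenvalues_le hA k).trans hAR.le)
      have h4 := (hq _ ⟨h3.1, h3.2⟩).le
      rw [abs_sub_comm] at h4
      rw [← sub_mul, ← mul_sub, abs_mul, abs_mul]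
      calc _ ≤ 1 * (ε / (3 * c)) * 1 := by gcongr
        _ = _ := by ring
    refine (Finset.sum_le_sum this).trans ?_
    rw [Finset.sum_const, Finset.card_univ, nsmul_eq_mul]
    have : (Fintype.card ι : ℝ) ≤ c := by simp [hc]
    calc (Fintype.card ι : ℝ) * (ε / (3 * c)) ≤ c * (ε / (3 * c)) := by gcongr
      _ = ε / 3 := by field_simp
  have hpoly : Continuous fun A : Matrix ι ι ℝ => (Polynomial.aeval A q) i j :=
    (continuous_apply_apply i j).comp (Polynomial.continuous_aeval (R := ℝ) q)
  have h1 : ∀ᶠ A in 𝓝[{A : Matrix ι ι ℝ | A.IsHermitian}] A₀, (∑ i, ∑ j, |A i j|) < R := by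
    refine Filter.Tendsto.eventually_lt_const (u := R) (v := ∑ i, ∑ j, |A₀ i j|) (by simp [hR]) ?_
    have : Continuous fun A : Matrix ι ι ℝ => ∑ i, ∑ j, |A i j| := by fun_prop
    exact this.continuousAt.tendsto.mono_left nhdsWithin_le_nhds
  have h2 : ∀ᶠ A in 𝓝[{A : Matrix ι ι ℝ | A.IsHermitian}] A₀,
      dist ((Polynomial.aeval A q) i j) ((Polynomial.aeval A₀ q) i j) < ε / 3 :=
    (Metric.tendsto_nhds.1 (hpoly.continuousAt.tendsto.mono_left nhdsWithin_le_nhds)) _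
      (by positivity)
  filter_upwards [h1, h2, self_mem_nhdsWithin] with A hA1 hA2 hA3
  have a1 := key A hA3 hA1
  have a2 := key A₀ hA₀ (by simp [hR])
  rw [Real.dist_eq] at hA2 ⊢
  calc |cfc f A i j - cfc f A₀ i j|
      = |(cfc f A i j - (Polynomial.aeval A q) i j) +
          ((Polynomial.aeval A q) i j - (Polynomial.aeval A₀ q) i j) -
          (cfc f A₀ i j - (Polynomial.aeval A₀ q) i j)| := by ring_nf
    _ ≤ |cfc f A i j - (Polynomial.aeval A q) i j| +
          |(Polynomial.aeval A q) i j - (Polynomial.aeval A₀ q) i j| +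
          |cfc f A₀ i j - (Polynomial.aeval A₀ q) i j| :=
        (abs_sub _ _).trans (by gcongr; exact abs_add_le _ _)
    _ < ε := by linarith

omit [Fintype ι] [DecidableEq ι] in
theorem isClosed_isHermitian : IsClosed {A : Matrix ι ι ℝ | A.IsHermitian} := by
  have : {A : Matrix ι ι ℝ | A.IsHermitian} = {A | Aᵀ = A} := by
    ext A; simp [Matrix.IsHermitian, Matrix.conjTranspose_eq_transpose_of_trivial]
  rw [this]
  exact isClosed_eq (by fun_prop) continuous_id

/-- The functional calculus of a random matrix is random, for every function that is a pointwise
limit of continuous functions. -/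
theorem measurable_cfc_apply {Ω : Type*} [MeasurableSpace Ω] {A : Ω → Matrix ι ι ℝ}
    (hA : ∀ i j, Measurable fun ω => A ω i j) {f : ℝ → ℝ} {g : ℕ → ℝ → ℝ}
    (hg : ∀ n, Continuous (g n)) (hgf : ∀ x, Tendsto (fun n => g n x) atTop (𝓝 (f x))) (i j : ι) :
    Measurable fun ω => cfc f (A ω) i j := by
  let _ : MeasurableSpace (Matrix ι ι ℝ) := inferInstanceAs (MeasurableSpace (ι → ι → ℝ))
  have _ : BorelSpace (Matrix ι ι ℝ) := inferInstanceAs (BorelSpace (ι → ι → ℝ))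
  have hA' : Measurable A := by
    refine measurable_pi_iff.2 fun i => measurable_pi_iff.2 fun j => hA i j
  have step : ∀ n, Measurable fun ω => cfc (g n) (A ω) i j := by
    intro n
    have hcont : ContinuousOn (fun B : Matrix ι ι ℝ => cfc (g n) B i j) {B | B.IsHermitian} :=
      continuousOn_pi.1 (continuousOn_pi.1 (continuousOn_cfc_isHermitian (hg n)) i) j
    classical
    have hm := hcont.measurable_piecewise (continuousOn_const (c := (0 : ℝ)))
      isClosed_isHermitian.measurableSet
    have heq : (fun B : Matrix ι ι ℝ => cfc (g n) B i j) =
        Set.piecewise {B : Matrix ι ι ℝ | B.IsHermitian}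
          (fun B : Matrix ι ι ℝ => cfc (g n) B i j) (fun _ => 0) := by
      funext B
      by_cases hB : B.IsHermitian
      · rw [Set.piecewise_eq_of_mem _ _ _ (by exact hB)]
      · have h0 : cfc (g n) B = 0 := cfc_apply_of_not_predicate B hB
        rw [Set.piecewise_eq_of_notMem _ _ _ (by exact hB)]
        exact congrFun (congrFun h0 i) j
    rw [← heq] at hm
    exact hm.comp hA'
  refine measurable_of_tendsto_metrizable step (tendsto_pi_nhds.2 fun ω => ?_)
  by_cases hω : (A ω).IsHermitian
  · simp only [cfc_apply_eq_sum hω]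
    exact tendsto_finsetSum _ fun k _ => ((hgf _).const_mul _).mul_const _
  · have h0 : ∀ h : ℝ → ℝ, cfc h (A ω) = 0 := fun h => cfc_apply_of_not_predicate (A ω) hω
    simp only [h0]
    exact tendsto_const_nhds

theorem measurable_symRoot_apply {Ω : Type*} [MeasurableSpace Ω] {A : Ω → Matrix ι ι ℝ}
    (hA : ∀ i j, Measurable fun ω => A ω i j) (i j : ι) :
    Measurable fun ω => symRoot (A ω) i j :=
  measurable_cfc_apply hA (g := fun _ => Real.sqrt) (fun _ => Real.continuous_sqrt)
    (fun _ => tendsto_const_nhds) i j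

theorem measurable_symPinv_apply {Ω : Type*} [MeasurableSpace Ω] {A : Ω → Matrix ι ι ℝ}
    (hA : ∀ i j, Measurable fun ω => A ω i j) (i j : ι) :
    Measurable fun ω => symPinv (A ω) i j := by
  -- `x⁻¹` is the pointwise limit of `x / (x ^ 2 + 1 / (n + 1))`, also at `x = 0`
  refine measurable_cfc_apply hA (g := fun n x => x / (x ^ 2 + 1 / ((n : ℝ) + 1)))
    (fun n => ?_) (fun x => ?_) i j
  · exact continuous_id.div (by fun_prop) fun x => by positivity
  · by_cases hx : x = 0
    · simp [hx]
    · have h : Tendsto (fun n : ℕ => x / (x ^ 2 + 1 / ((n : ℝ) + 1))) atTop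
          (𝓝 (x / (x ^ 2 + 0))) :=
        tendsto_const_nhds.div (tendsto_const_nhds.add tendsto_one_div_add_atTop_nhds_zero_nat)
          (by simpa using hx)
      have e : x / (x ^ 2 + 0) = x⁻¹ := by field_simp; ring
      rwa [e] at h

theorem isHermitian_cfc (f : ℝ → ℝ) (A : Matrix ι ι ℝ) : (cfc f A).IsHermitian :=
  cfc_predicate f A

theorem isHermitian_symRoot (A : Matrix ι ι ℝ) : (symRoot A).IsHermitian :=
  isHermitian_cfc _ A

theorem symPinv_eq_inv {A : Matrix ι ι ℝ} (hA : A.IsHermitian) (hu : IsUnit A) :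
    symPinv A = A⁻¹ := by
  have hdet : IsUnit A.det := (Matrix.isUnit_iff_isUnit_det A).1 hu
  have h := (symPinv_penrose hA).1
  calc symPinv A = A⁻¹ * (A * symPinv A * A) * A⁻¹ := by
        rw [mul_assoc A, Matrix.nonsing_inv_mul_cancel_left _ _ hdet,
          Matrix.mul_nonsing_inv_cancel_right _ _ hdet]
    _ = A⁻¹ := by rw [h, Matrix.nonsing_inv_mul _ hdet, one_mul]

theorem cfc_smul_arg {A : Matrix ι ι ℝ} (hA : A.IsHermitian) (c : ℝ) (f : ℝ → ℝ) :
    cfc f (c • A) = cfc (fun x => f (c * x)) A :=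
  (cfc_comp_const_mul c f A
    ((Set.toFinite _).continuousOn _) hA).symm

theorem symPinv_smul {A : Matrix ι ι ℝ} (hA : A.IsHermitian) (c : ℝ) :
    symPinv (c • A) = c⁻¹ • symPinv A := by
  rw [symPinv, cfc_smul_arg hA, symPinv, ← cfc_const_mul c⁻¹ _ A (continuousOn_spectrum_matrix A _)]
  refine cfc_congr fun x _ => ?_
  rw [mul_inv]

theorem symRoot_smul {A : Matrix ι ι ℝ} (hA : A.IsHermitian) {c : ℝ} (hc : 0 ≤ c) :
    symRoot (c • A) = √c • symRoot A := by
  rw [symRoot, cfc_smul_arg hA, symRoot, ← cfc_const_mul (√c) _ A (continuousOn_spectrum_matrix A _)]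
  refine cfc_congr fun x _ => ?_
  simp [Real.sqrt_mul hc]

/-- The symmetric root of a positive definite matrix is invertible. -/
theorem isUnit_symRoot {A : Matrix ι ι ℝ} (hA : A.PosDef) : IsUnit (symRoot A) := by
  have h := (symRoot_mul_self hA.posSemidef).2
  have hd : IsUnit A.det := (Matrix.isUnit_iff_isUnit_det A).1 hA.isUnit
  rw [← h, Matrix.det_mul] at hd
  exact (Matrix.isUnit_iff_isUnit_det _).2 (isUnit_of_mul_isUnit_left hd)

theorem continuousWithinAt_symPinv {A : Matrix ι ι ℝ} (hA : A.IsHermitian) (hu : IsUnit A) :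
    ContinuousWithinAt (fun B : Matrix ι ι ℝ => symPinv B) {B | B.IsHermitian} A := by
  have hd : IsUnit A.det := (Matrix.isUnit_iff_isUnit_det A).1 hu
  have hinv : ContinuousAt (fun B : Matrix ι ι ℝ => B⁻¹) A :=
    continuousAt_matrix_inv A (NormedRing.inverse_continuousAt hd.unit)
  have hne : ∀ᶠ B : Matrix ι ι ℝ in 𝓝 A, B.det ≠ 0 :=
    (Continuous.matrix_det continuous_id).continuousAt.eventually_ne hd.ne_zero
  refine hinv.continuousWithinAt.congr_of_eventuallyEq ?_ (symPinv_eq_inv hA hu)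
  filter_upwards [hne.filter_mono nhdsWithin_le_nhds, self_mem_nhdsWithin] with B hB hB'
  exact symPinv_eq_inv hB' ((Matrix.isUnit_iff_isUnit_det B).2 hB.isUnit)

/-- `A ↦ A^{-1/2}` is continuous, on the symmetric matrices, at a positive definite matrix. -/
theorem continuousWithinAt_symPinv_symRoot {A : Matrix ι ι ℝ} (hA : A.PosDef) :
    ContinuousWithinAt (fun B : Matrix ι ι ℝ => symPinv (symRoot B)) {B | B.IsHermitian} A :=
  ContinuousWithinAt.comp (t := {B : Matrix ι ι ℝ | B.IsHermitian})
    (continuousWithinAt_symPinv (isHermitian_cfc _ _) (isUnit_symRoot hA))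
    (continuousOn_cfc_isHermitian Real.continuous_sqrt A hA.isHermitian)
    fun _ _ => isHermitian_cfc _ _

end SymmetricMatrix

/-! ### Partial derivatives: regularity, measurability and the mean value formula -/

section PartialDerivatives

variable {ι : Type*} [Fintype ι] [DecidableEq ι]

theorem contDiff_partialD {n m : WithTop ℕ∞} {f : EuclideanSpace ℝ ι → ℝ} (hf : ContDiff ℝ n f)
    (hnm : m + 1 ≤ n) (s : ι) : ContDiff ℝ m (partialD f s) :=
  (hf.fderiv_right hnm).clm_apply contDiff_const

theorem measurable_partialD {Ω : Type*} [MeasurableSpace Ω] {f : Ω → EuclideanSpace ℝ ι → ℝ}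
    (hm : ∀ u, Measurable fun ω => f ω u) (hd : ∀ ω, ContDiff ℝ 1 (f ω)) (s : ι)
    (u : EuclideanSpace ℝ ι) : Measurable fun ω => partialD (f ω) s u := by
  refine measurable_of_tendsto_metrizable (f := fun (n : ℕ) ω =>
    (n : ℝ) * (f ω (u + (n : ℝ)⁻¹ • EuclideanSpace.single s 1) - f ω u)) (fun n => ?_)
    (tendsto_pi_nhds.2 fun ω => ?_)
  · exact ((hm _).sub (hm _)).const_mul _
  · have h := ((hd ω).differentiable (by simp) u).hasFDerivAt.lim_real (EuclideanSpace.single s 1)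
    exact h.comp tendsto_natCast_atTop_atTop

omit [DecidableEq ι] in
/-- A function that is measurable in one argument and continuous in the other may be evaluated at
a measurable argument. -/
theorem measurable_eval_of_continuous {Ω : Type*} [MeasurableSpace Ω]
    {f : Ω → EuclideanSpace ℝ ι → ℝ}
    (hm : ∀ u, Measurable fun ω => f ω u) (hc : ∀ ω, Continuous (f ω))
    {g : Ω → EuclideanSpace ℝ ι} (hg : Measurable g) : Measurable fun ω => f ω (g ω) := by
  have h := measurable_uncurry_of_continuous_of_measurable (u := fun u ω => f ω u) hc hm
  exact h.comp (hg.prodMk measurable_id)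

theorem measurable_scoreVec {Ω : Type*} [MeasurableSpace Ω] {f : Ω → EuclideanSpace ℝ ι → ℝ}
    (hm : ∀ u, Measurable fun ω => f ω u) (hd : ∀ ω, ContDiff ℝ 1 (f ω))
    {g : Ω → EuclideanSpace ℝ ι} (hg : Measurable g) :
    Measurable fun ω => scoreVec (f ω) (g ω) := by
  refine (WithLp.measurable_toLp 2 _).comp (measurable_pi_iff.2 fun s => ?_)
  exact measurable_eval_of_continuous (measurable_partialD hm hd s)
    (fun ω => (contDiff_partialD (m := 0) (hd ω) (by simp) s).continuous) hg

theorem measurable_hessianMat {Ω : Type*} [MeasurableSpace Ω] {f : Ω → EuclideanSpace ℝ ι → ℝ}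
    (hm : ∀ u, Measurable fun ω => f ω u) (hd : ∀ ω, ContDiff ℝ 2 (f ω))
    {g : Ω → EuclideanSpace ℝ ι} (hg : Measurable g) (s t : ι) :
    Measurable fun ω => hessianMat (f ω) (g ω) s t := by
  have hd1 : ∀ ω, ContDiff ℝ 1 (partialD (f ω) t) :=
    fun ω => contDiff_partialD (hd ω) (by norm_num [one_add_one_eq_two]) t
  have hm1 : ∀ u, Measurable fun ω => partialD (f ω) t u :=
    measurable_partialD hm (fun ω => (hd ω).of_le (by norm_num)) t
  exact measurable_eval_of_continuous (measurable_partialD hm1 hd1 s)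
    (fun ω => (contDiff_partialD (m := 0) (hd1 ω) (by simp) s).continuous) hg

theorem isHermitian_hessianMat {f : EuclideanSpace ℝ ι → ℝ} (hf : ContDiff ℝ 2 f)
    (u : EuclideanSpace ℝ ι) : (hessianMat f u).IsHermitian := by
  have hd : DifferentiableAt ℝ (fderiv ℝ f) u :=
    ((hf.fderiv_right (m := 1) (by norm_num [one_add_one_eq_two])).differentiable (by simp)) u
  have h : ∀ s t, hessianMat f u s t =
      fderiv ℝ (fderiv ℝ f) u (EuclideanSpace.single s 1) (EuclideanSpace.single t 1) := by
    intro s t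
    change fderiv ℝ (fun w => fderiv ℝ f w (EuclideanSpace.single t 1)) u _ = _
    rw [fderiv_clm_apply hd (by fun_prop)]
    simp
  refine Matrix.IsHermitian.ext fun s t => ?_
  rw [h, h, star_trivial]
  exact (hf.contDiffAt.isSymmSndFDerivAt (by simp)) _ _

theorem fderiv_apply_eq_sum_partialD (f : EuclideanSpace ℝ ι → ℝ) (u v : EuclideanSpace ℝ ι) :
    fderiv ℝ f u v = ∑ s, v s * partialD f s u := by
  have hv : v = ∑ s, v s • EuclideanSpace.single s (1 : ℝ) := by
    ext i
    simp [Finset.sum_apply, Pi.single_apply]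
  conv_lhs => rw [hv]
  rw [map_sum]
  simp [partialD]

/-- The mean value formula for the score, with the second derivatives averaged over the segment. -/
theorem partialD_sub_eq_integral_hessianMat {f : EuclideanSpace ℝ ι → ℝ} (hf : ContDiff ℝ 2 f)
    (u v : EuclideanSpace ℝ ι) (t : ι) :
    partialD f t v - partialD f t u =
      ∑ s, (∫ τ in (0 : ℝ)..1, hessianMat f (u + τ • (v - u)) s t) * (v - u) s := by
  have hd1 : ContDiff ℝ 1 (partialD f t) :=
    contDiff_partialD hf (by norm_num [one_add_one_eq_two]) t
  have hcont : ∀ s, Continuous fun τ : ℝ => hessianMat f (u + τ • (v - u)) s t := fun s =>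
    (contDiff_partialD (m := 0) hd1 (by simp) s).continuous.comp (by fun_prop)
  have hderiv : ∀ τ ∈ Set.uIcc (0 : ℝ) 1, HasDerivAt (fun τ : ℝ => partialD f t (u + τ • (v - u)))
      (∑ s, hessianMat f (u + τ • (v - u)) s t * (v - u) s) τ := by
    intro τ _
    have h1 : HasDerivAt (fun τ : ℝ => u + τ • (v - u)) (v - u) τ := by
      simpa using ((hasDerivAt_id τ).smul_const (v - u)).const_add u
    have h2 := ((hd1.differentiable (by simp)) (u + τ • (v - u))).hasFDerivAt.comp_hasDerivAt τ h1
    rw [fderiv_apply_eq_sum_partialD] at h2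
    refine h2.congr_deriv (Finset.sum_congr rfl fun s _ => mul_comm _ _)
  have h := intervalIntegral.integral_eq_sub_of_hasDerivAt hderiv
    ((continuous_finsetSum _ fun s _ => (hcont s).mul_const _).intervalIntegrable 0 1)
  rw [intervalIntegral.integral_finsetSum fun s _ => ((hcont s).mul_const _).intervalIntegrable 0 1]
    at h
  simp only [intervalIntegral.integral_mul_const] at h
  rw [h]
  simp

theorem partialD_sum {κ : Type*} (F : Finset κ) {f : κ → EuclideanSpace ℝ ι → ℝ}
    {u : EuclideanSpace ℝ ι} (hf : ∀ k ∈ F, DifferentiableAt ℝ (f k) u) (s : ι) :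
    partialD (fun w => ∑ k ∈ F, f k w) s u = ∑ k ∈ F, partialD (f k) s u := by
  simp only [partialD]
  rw [fderiv_fun_sum hf, sum_apply]

theorem partialD_exp {f : EuclideanSpace ℝ ι → ℝ} {u : EuclideanSpace ℝ ι}
    (hf : DifferentiableAt ℝ f u) (s : ι) :
    partialD (fun w => Real.exp (f w)) s u = Real.exp (f u) * partialD f s u := by
  simp only [partialD]
  rw [fderiv_exp hf]
  simp

theorem partialD_mul {f g : EuclideanSpace ℝ ι → ℝ} {u : EuclideanSpace ℝ ι}
    (hf : DifferentiableAt ℝ f u) (hg : DifferentiableAt ℝ g u) (s : ι) :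
    partialD (fun w => f w * g w) s u = f u * partialD g s u + g u * partialD f s u := by
  simp only [partialD]
  rw [fderiv_fun_mul hf hg]
  simp

@[simp] theorem partialD_const (c : ℝ) (s : ι) (u : EuclideanSpace ℝ ι) :
    partialD (fun _ => c) s u = 0 := by
  simp [partialD]

/-- The score of a finite family of probabilities has mean zero. -/
theorem sum_exp_mul_partialD_eq_zero {κ : Type*} [Fintype κ] {L : κ → EuclideanSpace ℝ ι → ℝ}
    (hL : ∀ k, Differentiable ℝ (L k)) (hsum : ∀ u, ∑ k, Real.exp (L k u) = 1) (s : ι)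
    (u : EuclideanSpace ℝ ι) : ∑ k, Real.exp (L k u) * partialD (L k) s u = 0 := by
  have h : partialD (fun w => ∑ k, Real.exp (L k w)) s u = 0 := by
    simp [hsum]
  rw [partialD_sum _ fun k _ => (hL k u).exp] at h
  simpa only [partialD_exp (hL _ u)] using h

/-- The information identity for a finite family of probabilities. -/
theorem sum_exp_mul_hessianMat {κ : Type*} [Fintype κ] {L : κ → EuclideanSpace ℝ ι → ℝ}
    (hL : ∀ k, ContDiff ℝ 2 (L k)) (hsum : ∀ u, ∑ k, Real.exp (L k u) = 1) (s t : ι)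
    (u : EuclideanSpace ℝ ι) :
    ∑ k, Real.exp (L k u) * hessianMat (L k) u s t =
      -∑ k, Real.exp (L k u) * (partialD (L k) s u * partialD (L k) t u) := by
  have hd : ∀ k, Differentiable ℝ (L k) := fun k => (hL k).differentiable (by simp)
  have hd' : ∀ k, Differentiable ℝ (partialD (L k) t) := fun k =>
    (contDiff_partialD (m := 1) (hL k) (by norm_num [one_add_one_eq_two]) t).differentiable (by simp)
  have h : partialD (fun w => ∑ k, Real.exp (L k w) * partialD (L k) t w) s u = 0 := by
    simp [sum_exp_mul_partialD_eq_zero hd hsum]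
  rw [partialD_sum _ fun k _ => ((hd k u).exp).fun_mul (hd' k u)] at h
  rw [eq_neg_iff_add_eq_zero, ← Finset.sum_add_distrib, ← h]
  refine Finset.sum_congr rfl fun k _ => ?_
  rw [partialD_mul (hd k u).exp (hd' k u), partialD_exp (hd k u)]
  simp only [hessianMat, Matrix.of_apply]
  ring

end PartialDerivatives

/-! ### Regularity of the conditional log-likelihood -/

namespace AssociationModel

variable {ΩX ΩY : Type*} [MeasurableSpace ΩX] [MeasurableSpace ΩY] {dX dY S K : ℕ}
  (M : AssociationModel ΩX ΩY dX dY S K)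

/-- The exponent `γ_k + ψ_θ(x, y_k)` of the multinomial logit probabilities. -/
def linPred (k : Fin (K + 1)) (x : ΩX) (u : Param S K) : ℝ :=
  u.gamma k + M.logOR u.theta x (M.y k)

theorem contDiff_gamma (k : Fin (K + 1)) : ContDiff ℝ 3 fun u : Param S K => u.gamma k := by
  refine Fin.cases ?_ (fun j => ?_) k
  · simpa [Param.gamma] using contDiff_const
  · simp only [Param.gamma, Fin.cons_succ]
    fun_prop

theorem contDiff_theta : ContDiff ℝ 3 (Param.theta : Param S K → EuclideanSpace ℝ (Fin S)) := by
  refine contDiff_euclidean.2 fun s => ?_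
  simp only [Param.theta]
  fun_prop

theorem contDiff_linPred (k : Fin (K + 1)) (x : ΩX) : ContDiff ℝ 3 (M.linPred k x) :=
  (contDiff_gamma k).add ((M.contDiff_G x (M.y k)).comp contDiff_theta)

theorem measurable_linPred (k : Fin (K + 1)) (u : Param S K) :
    Measurable fun x => M.linPred k x u :=
  measurable_const.add ((M.measurable_logOR u.theta).comp measurable_prodMk_right)

theorem sum_exp_linPred_pos (x : ΩX) (u : Param S K) : 0 < ∑ l, Real.exp (M.linPred l x u) :=
  Finset.sum_pos (fun _ _ => Real.exp_pos _) Finset.univ_nonempty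

theorem prob_eq (k : Fin (K + 1)) (x : ΩX) (u : Param S K) :
    M.prob k x u = Real.exp (M.linPred k x u) / ∑ l, Real.exp (M.linPred l x u) := rfl

theorem prob_pos (k : Fin (K + 1)) (x : ΩX) (u : Param S K) : 0 < M.prob k x u :=
  div_pos (Real.exp_pos _) (M.sum_exp_linPred_pos x u)

theorem sum_prob (x : ΩX) (u : Param S K) : ∑ k, M.prob k x u = 1 := by
  simp only [prob_eq]
  rw [← Finset.sum_div, div_self (M.sum_exp_linPred_pos x u).ne']

theorem exp_logProb (k : Fin (K + 1)) (x : ΩX) (u : Param S K) :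
    Real.exp (M.logProb k x u) = M.prob k x u :=
  Real.exp_log (M.prob_pos k x u)

theorem sum_exp_logProb (x : ΩX) (u : Param S K) : ∑ k, Real.exp (M.logProb k x u) = 1 := by
  simp only [exp_logProb, sum_prob]

theorem logProb_eq (k : Fin (K + 1)) (x : ΩX) (u : Param S K) :
    M.logProb k x u = M.linPred k x u - Real.log (∑ l, Real.exp (M.linPred l x u)) := by
  rw [logProb, prob_eq, Real.log_div (Real.exp_pos _).ne' (M.sum_exp_linPred_pos x u).ne',
    Real.log_exp]

theorem contDiff_logProb (k : Fin (K + 1)) (x : ΩX) : ContDiff ℝ 3 (M.logProb k x) := by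
  have h : M.logProb k x =
      fun u => M.linPred k x u - Real.log (∑ l, Real.exp (M.linPred l x u)) :=
    funext fun u => M.logProb_eq k x u
  rw [h]
  refine (M.contDiff_linPred k x).sub (ContDiff.log ?_ fun u => (M.sum_exp_linPred_pos x u).ne')
  exact ContDiff.sum fun l _ => (M.contDiff_linPred l x).exp

theorem differentiable_logProb (k : Fin (K + 1)) (x : ΩX) : Differentiable ℝ (M.logProb k x) :=
  (M.contDiff_logProb k x).differentiable (by simp)

theorem measurable_prob (k : Fin (K + 1)) (u : Param S K) : Measurable fun x => M.prob k x u :=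
  (M.measurable_linPred k u).exp.div
    (Finset.measurable_fun_sum _ fun l _ => (M.measurable_linPred l u).exp)

theorem measurable_logProb (k : Fin (K + 1)) (u : Param S K) :
    Measurable fun x => M.logProb k x u :=
  (M.measurable_prob k u).log

/-- The derivative of `log p*_k` in the nuisance parameter `γ_l`, `l ≥ 1`. -/
theorem partialD_logProb_inr (k : Fin (K + 1)) (x : ΩX) (l : Fin K) (u : Param S K) :
    partialD (M.logProb k x) (Sum.inr l) u =
      (if k = l.succ then 1 else 0) - M.prob l.succ x u := by
  have hlin : ∀ j, partialD (M.linPred j x) (Sum.inr l) u = if j = l.succ then 1 else 0 := by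
    intro j
    have hline : ∀ t : ℝ, M.linPred j x (u + t • EuclideanSpace.single (Sum.inr l) 1) =
        M.linPred j x u + t * (if j = l.succ then 1 else 0) := by
      intro t
      have h1 : Param.theta (u + t • EuclideanSpace.single (Sum.inr l) 1 : Param S K) =
          u.theta := by
        ext s; simp [Param.theta]
      have h2 : Param.gamma (u + t • EuclideanSpace.single (Sum.inr l) 1 : Param S K) j =
          u.gamma j + t * (if j = l.succ then 1 else 0) := by
        refine Fin.cases ?_ (fun i => ?_) j
        · simp [Param.gamma, (Fin.succ_ne_zero l).symm]
        · simp [Param.gamma, PiLp.single_apply]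
      rw [linPred, linPred, h1, h2]
      ring
    have hd : DifferentiableAt ℝ (M.linPred j x) u :=
      ((M.contDiff_linPred j x).differentiable (by simp)) u
    rw [partialD, ← hd.lineDeriv_eq_fderiv, lineDeriv]
    simp only [hline]
    rw [deriv_const_add, deriv_mul_const_field]
    simp
  have hd : ∀ j, DifferentiableAt ℝ (M.linPred j x) u := fun j =>
    ((M.contDiff_linPred j x).differentiable (by simp)) u
  have hsum : partialD (fun w => ∑ j, Real.exp (M.linPred j x w)) (Sum.inr l) u =
      Real.exp (M.linPred l.succ x u) := by
    rw [partialD_sum _ fun j _ => (hd j).exp]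
    simp only [partialD_exp (hd _), hlin]
    simp
  have hds : DifferentiableAt ℝ (fun w => ∑ j, Real.exp (M.linPred j x w)) u :=
    DifferentiableAt.fun_sum fun j _ => (hd j).exp
  have h : M.logProb k x =
      fun u => M.linPred k x u - Real.log (∑ l, Real.exp (M.linPred l x u)) :=
    funext fun u => M.logProb_eq k x u
  have hpos := (M.sum_exp_linPred_pos x u).ne'
  have e1 := hlin k
  rw [partialD] at e1 hsum ⊢
  rw [h, fderiv_fun_sub (hd k) (hds.log hpos), fderiv.log hds hpos]
  simp only [sub_apply, smul_apply, smul_eq_mul]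
  rw [e1, hsum, prob_eq, div_eq_inv_mul]

theorem contDiff_logLik (N : Fin (K + 1) → ℕ) (x : Fin (K + 1) → ℕ → ΩX) :
    ContDiff ℝ 3 (M.logLik N x) :=
  ContDiff.sum fun k _ => ContDiff.sum fun i _ => M.contDiff_logProb k (x k i)

theorem partialD_logLik (N : Fin (K + 1) → ℕ) (x : Fin (K + 1) → ℕ → ΩX) (s : Fin S ⊕ Fin K)
    (u : Param S K) : partialD (M.logLik N x) s u =
      ∑ k, ∑ i ∈ Finset.range (N k), partialD (M.logProb k (x k i)) s u := by
  have hd : ∀ k i, DifferentiableAt ℝ (M.logProb k (x k i)) u :=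
    fun k i => M.differentiable_logProb k _ u
  have h : M.logLik N x = fun w => ∑ k, ∑ i ∈ Finset.range (N k), M.logProb k (x k i) w := rfl
  rw [h, partialD_sum _ fun k _ => DifferentiableAt.fun_sum fun i _ => hd k i]
  exact Finset.sum_congr rfl fun k _ => partialD_sum _ (fun i _ => hd k i) s

theorem measurable_logLik {Ω : Type*} [MeasurableSpace Ω] (N : Fin (K + 1) → ℕ)
    {X : Fin (K + 1) → ℕ → Ω → ΩX} (hX : ∀ k i, Measurable (X k i)) (u : Param S K) :
    Measurable fun ω => M.logLik N (fun k i => X k i ω) u :=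
  Finset.measurable_fun_sum _ fun k _ => Finset.measurable_fun_sum _ fun i _ =>
    (M.measurable_logProb k u).comp (hX k i)

theorem isHermitian_obsInfo (N : Fin (K + 1) → ℕ) (x : Fin (K + 1) → ℕ → ΩX) (u : Param S K) :
    (M.obsInfo N x u).IsHermitian :=
  (isHermitian_hessianMat ((M.contDiff_logLik N x).of_le (by norm_num)) u).neg

/-! ### Sampling conditional on `X` -/

instance isFiniteMeasure_labelLaw (x : ΩX) (u : Param S K) : IsFiniteMeasure (M.labelLaw x u) := by
  unfold labelLaw
  have : ∀ k, IsFiniteMeasure (ENNReal.ofReal (M.prob k x u) • Measure.dirac k) := fun k =>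
    Measure.smul_finite _ ENNReal.ofReal_ne_top
  infer_instance

theorem labelLaw_singleton (x : ΩX) (u : Param S K) (k : Fin (K + 1)) :
    M.labelLaw x u {k} = ENNReal.ofReal (M.prob k x u) := by
  simp [labelLaw, Set.indicator_apply]

/-- The likelihood of the observed labels given the design points is the product of the modelled
probabilities, so that both sampling schemes have the same log-likelihood. -/
theorem log_labelsLaw_real (N : Fin (K + 1) → ℕ) (x : Fin (K + 1) → ℕ → ΩX) (u : Param S K) :
    Real.log ((M.labelsLaw (fun j : (Σ k, Fin (N k)) => x j.1 j.2) u).real {fun j => j.1}) =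
      M.logLik N x u := by
  rw [labelsLaw, Measure.real, Measure.pi_singleton]
  simp only [labelLaw_singleton]
  rw [ENNReal.toReal_prod]
  simp only [ENNReal.toReal_ofReal (M.prob_pos _ _ _).le]
  rw [Real.log_prod fun j _ => (M.prob_pos _ _ _).ne', Fintype.sum_sigma, logLik]
  refine Finset.sum_congr rfl fun k _ => ?_
  rw [Finset.sum_range]
  rfl

theorem obsInfoGivenX_eq_obsInfo (N : Fin (K + 1) → ℕ) (x : Fin (K + 1) → ℕ → ΩX)
    (u : Param S K) : M.obsInfoGivenX N x u = M.obsInfo N x u := by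
  simp only [obsInfoGivenX, obsInfo, log_labelsLaw_real]

end AssociationModel

/-! ### The information matrix at the true parameter -/

namespace AssociationModel

variable {ΩX ΩY : Type*} [MeasurableSpace ΩX] [MeasurableSpace ΩY] {dX dY S K : ℕ}
  {M : AssociationModel ΩX ΩY dX dY S K} {νX : Measure ΩX} {νY : Measure ΩY}
  {p : ΩX → ΩY → ℝ} {θ₀ : EuclideanSpace ℝ (Fin S)} {r : Fin (K + 1) → ℝ}

namespace IsJointDensity

theorem measurable_slice (hp : M.IsJointDensity νX νY θ₀ p) (k : Fin (K + 1)) :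
    Measurable fun x => p x (M.y k) :=
  hp.measurable.comp measurable_prodMk_right

theorem integral_slice_pos (hp : M.IsJointDensity νX νY θ₀ p) (k : Fin (K + 1)) :
    0 < ∫ x, p x (M.y k) ∂νX := by
  rw [integral_pos_iff_support_of_nonneg (fun x => (hp.pos x _).le) (hp.integrable_slice k)]
  have hs : Function.support (fun x => p x (M.y k)) = Set.univ :=
    Set.eq_univ_of_forall fun x => (hp.pos x _).ne'
  rw [hs, pos_iff_ne_zero, Ne, Measure.measure_univ_eq_zero]
  intro h0
  have h := hp.lintegral_eq_one
  rw [h0, Measure.zero_prod, lintegral_zero_measure] at h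
  exact zero_ne_one h

theorem condDensity_pos (hp : M.IsJointDensity νX νY θ₀ p) (k : Fin (K + 1)) (x : ΩX) :
    0 < M.condDensity νX p k x :=
  div_pos (hp.pos x _) (hp.integral_slice_pos k)

theorem measurable_condDensity (hp : M.IsJointDensity νX νY θ₀ p) (k : Fin (K + 1)) :
    Measurable (M.condDensity νX p k) :=
  (hp.measurable_slice k).div_const _

theorem isProbabilityMeasure_condLaw (hp : M.IsJointDensity νX νY θ₀ p) (k : Fin (K + 1)) :
    IsProbabilityMeasure (M.condLaw νX p k) := by
  constructor
  have hint : Integrable (M.condDensity νX p k) νX := (hp.integrable_slice k).div_const _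
  rw [condLaw, withDensity_apply _ MeasurableSet.univ, Measure.restrict_univ,
    ← ofReal_integral_eq_lintegral_ofReal hint
      (Eventually.of_forall fun x => (hp.condDensity_pos k x).le)]
  simp only [condDensity]
  rw [integral_div, div_self (hp.integral_slice_pos k).ne', ENNReal.ofReal_one]

theorem integrable_condLaw_iff (hp : M.IsJointDensity νX νY θ₀ p) (k : Fin (K + 1)) (g : ΩX → ℝ) :
    Integrable g (M.condLaw νX p k) ↔ Integrable (fun x => M.condDensity νX p k x * g x) νX := by
  rw [condLaw, integrable_withDensity_iff_integrable_smul'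
    (hp.measurable_condDensity k).ennreal_ofReal (Eventually.of_forall fun _ => ENNReal.ofReal_lt_top)]
  simp only [ENNReal.toReal_ofReal (hp.condDensity_pos k _).le, smul_eq_mul]

theorem integral_condLaw (hp : M.IsJointDensity νX νY θ₀ p) (k : Fin (K + 1)) (g : ΩX → ℝ) :
    ∫ x, g x ∂(M.condLaw νX p k) = ∫ x, M.condDensity νX p k x * g x ∂νX := by
  rw [condLaw, integral_withDensity_eq_integral_toReal_smul
    (hp.measurable_condDensity k).ennreal_ofReal (Eventually.of_forall fun _ => ENNReal.ofReal_lt_top)]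
  simp only [ENNReal.toReal_ofReal (hp.condDensity_pos k _).le, smul_eq_mul]

theorem exp_gamma_trueParam (hp : M.IsJointDensity νX νY θ₀ p) (hr : ∀ k, 0 < r k)
    (k : Fin (K + 1)) : Real.exp ((M.trueParam νX p r θ₀).gamma k) =
      r k * M.condDensity νX p k M.x₀ / (r 0 * M.condDensity νX p 0 M.x₀) := by
  have hpos : ∀ k, 0 < r k * M.condDensity νX p k M.x₀ :=
    fun k => mul_pos (hr k) (hp.condDensity_pos k _)
  have hsum : 0 < ∑ l, r l * M.condDensity νX p l M.x₀ :=
    Finset.sum_pos (fun l _ => hpos l) Finset.univ_nonempty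
  refine Fin.cases ?_ (fun j => ?_) k
  · simp [Param.gamma, div_self (hpos 0).ne']
  · have h : (M.trueParam νX p r θ₀).gamma j.succ = Real.log
        (r j.succ * M.condDensity νX p j.succ M.x₀ / (r 0 * M.condDensity νX p 0 M.x₀)) := by
      simp only [Param.gamma, Fin.cons_succ, trueParam, Param.mk, Sum.elim_inr, reverseProb]
      rw [div_div_div_cancel_right₀ hsum.ne']
    rw [h, Real.exp_log (div_pos (hpos _) (hpos 0))]

theorem exp_linPred_trueParam (hp : M.IsJointDensity νX νY θ₀ p) (hr : ∀ k, 0 < r k)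
    (k : Fin (K + 1)) (x : ΩX) : Real.exp (M.linPred k x (M.trueParam νX p r θ₀)) =
      r k * M.condDensity νX p k x / (r 0 * M.condDensity νX p 0 x) := by
  have hθ : (M.trueParam νX p r θ₀).theta = θ₀ := by
    ext s; simp [trueParam, Param.mk, Param.theta]
  have hpos := hp.pos
  rw [linPred, Real.exp_add, hp.exp_gamma_trueParam hr, hθ, ← hp.log_oddsRatio, Real.exp_log
    (div_pos (mul_pos (hpos _ _) (hpos _ _)) (mul_pos (hpos _ _) (hpos _ _)))]
  simp only [condDensity]
  have h0 := (hr 0).ne'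
  have h1 := (hp.integral_slice_pos k).ne'
  have h2 := (hp.integral_slice_pos 0).ne'
  have h3 := (hpos x (M.y 0)).ne'
  have h4 := (hpos M.x₀ (M.y 0)).ne'
  have h5 := (hpos M.x₀ (M.y k)).ne'
  field_simp

/-- Bayes' formula: at the true parameter the modelled probabilities are the conditional
probabilities of the labels given `x` when the labels are drawn with weights `r k`. -/
theorem mul_condDensity_eq (hp : M.IsJointDensity νX νY θ₀ p) (hr : ∀ k, 0 < r k)
    (k : Fin (K + 1)) (x : ΩX) : r k * M.condDensity νX p k x =
      M.prob k x (M.trueParam νX p r θ₀) * ∑ l, r l * M.condDensity νX p l x := by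
  have hpos : ∀ k, 0 < r k * M.condDensity νX p k x :=
    fun k => mul_pos (hr k) (hp.condDensity_pos k _)
  have hsum : 0 < ∑ l, r l * M.condDensity νX p l x :=
    Finset.sum_pos (fun l _ => hpos l) Finset.univ_nonempty
  simp only [prob_eq, hp.exp_linPred_trueParam hr]
  rw [← Finset.sum_div, div_div_div_cancel_right₀ (hpos 0).ne', div_mul_cancel₀ _ hsum.ne']

/-- Expectations under the case-control design vanish when they vanish conditionally on `x`. -/
theorem sum_mul_integral_eq_zero (hp : M.IsJointDensity νX νY θ₀ p) (hr : ∀ k, 0 < r k)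
    {g : Fin (K + 1) → ΩX → ℝ} (hg : ∀ k, Integrable (g k) (M.condLaw νX p k))
    (h0 : ∀ x, ∑ k, M.prob k x (M.trueParam νX p r θ₀) * g k x = 0) :
    ∑ k, r k * ∫ x, g k x ∂(M.condLaw νX p k) = 0 := by
  simp only [hp.integral_condLaw, ← integral_const_mul]
  rw [← integral_finsetSum _ fun k _ =>
    ((hp.integrable_condLaw_iff k (g k)).1 (hg k)).const_mul (r k)]
  refine integral_eq_zero_of_ae (Eventually.of_forall fun x => ?_)
  have h : ∑ k, r k * (M.condDensity νX p k x * g k x) =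
      (∑ k, M.prob k x (M.trueParam νX p r θ₀) * g k x) * ∑ l, r l * M.condDensity νX p l x := by
    rw [Finset.sum_mul]
    refine Finset.sum_congr rfl fun k _ => ?_
    rw [← mul_assoc, hp.mul_condDensity_eq hr]
    ring
  exact h.trans (by rw [h0, zero_mul]; rfl)

end IsJointDensity

variable (M νX p r)

/-- The mean of the score of one observation from the conditional law given `Y = y_k`. -/
def scoreMean (u : Param S K) (k : Fin (K + 1)) : Fin S ⊕ Fin K → ℝ :=
  fun s => ∫ x, partialD (M.logProb k x) s u ∂(M.condLaw νX p k)

/-- The limiting covariance matrix of the normalized score: the average, with weights `r k`, of the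
covariance matrices of the scores under the conditional laws given `Y = y_k`. -/
def scoreCov (u : Param S K) : Matrix (Fin S ⊕ Fin K) (Fin S ⊕ Fin K) ℝ :=
  Matrix.of fun s t => ∑ k, r k * cov[fun x => partialD (M.logProb k x) s u,
    fun x => partialD (M.logProb k x) t u; M.condLaw νX p k]

variable {M νX p r}

section Information

variable (hp : M.IsJointDensity νX νY θ₀ p) (hr : ∀ k, 0 < r k) {lam₀ : Param S K}
  (hlam₀ : lam₀ = M.trueParam νX p r θ₀)
  (hscore : ∀ k s, MemLp (fun x => partialD (M.logProb k x) s lam₀) 2 (M.condLaw νX p k))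
include hp hr hlam₀ hscore

/-- The scores of the single conditional laws need not be centred, but their average is. -/
theorem sum_mul_scoreMean (s : Fin S ⊕ Fin K) :
    ∑ k, r k * M.scoreMean νX p lam₀ k s = 0 := by
  have := hp.isProbabilityMeasure_condLaw
  refine hp.sum_mul_integral_eq_zero hr (fun k => (hscore k s).integrable (by norm_num)) fun x => ?_
  rw [← hlam₀]
  simpa only [exp_logProb] using sum_exp_mul_partialD_eq_zero
    (fun k => M.differentiable_logProb k x) (M.sum_exp_logProb x) s lam₀

/-- The information identity for the limiting information. -/
theorem limitInfo_eq_sum_integral_mul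
    (hhess : ∀ k s t, Integrable (fun x => hessianMat (M.logProb k x) lam₀ s t) (M.condLaw νX p k))
    (s t : Fin S ⊕ Fin K) : M.limitInfo νX p r lam₀ s t =
      ∑ k, r k * ∫ x, partialD (M.logProb k x) s lam₀ * partialD (M.logProb k x) t lam₀
        ∂(M.condLaw νX p k) := by
  have := hp.isProbabilityMeasure_condLaw
  have hint : ∀ k, Integrable
      (fun x => partialD (M.logProb k x) s lam₀ * partialD (M.logProb k x) t lam₀)
      (M.condLaw νX p k) := fun k => (hscore k s).integrable_mul (hscore k t)
  have h := hp.sum_mul_integral_eq_zero hr (fun k => (hhess k s t).add (hint k)) fun x => by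
    rw [← hlam₀]
    have h1 := sum_exp_mul_hessianMat (fun k => (M.contDiff_logProb k x).of_le (by norm_num))
      (M.sum_exp_logProb x) s t lam₀
    simp only [exp_logProb] at h1
    simp only [Pi.add_apply, mul_add, Finset.sum_add_distrib]
    rw [h1, neg_add_cancel]
  simp only [limitInfo, Matrix.of_apply, integral_neg]
  rw [← sub_eq_zero, ← neg_eq_zero, ← h, neg_sub, ← Finset.sum_sub_distrib]
  refine Finset.sum_congr rfl fun k _ => ?_
  simp only [Pi.add_apply]
  rw [integral_add (hhess k s t) (hint k)]
  ring

/-- The column of the limiting information belonging to the nuisance parameter `γ_l` is the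
weighted mean score given `Y = y_l`. -/
theorem limitInfo_inr
    (hhess : ∀ k s t, Integrable (fun x => hessianMat (M.logProb k x) lam₀ s t) (M.condLaw νX p k))
    (s : Fin S ⊕ Fin K) (l : Fin K) : M.limitInfo νX p r lam₀ s (Sum.inr l) =
      r l.succ * M.scoreMean νX p lam₀ l.succ s := by
  have := hp.isProbabilityMeasure_condLaw
  have hsc : ∀ k, Integrable (fun x => partialD (M.logProb k x) s lam₀) (M.condLaw νX p k) :=
    fun k => (hscore k s).integrable (by norm_num)
  have hint : ∀ k, Integrable
      (fun x => partialD (M.logProb k x) s lam₀ * M.prob l.succ x lam₀) (M.condLaw νX p k) := by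
    intro k
    refine (hsc k).mul_bdd (c := 1) (M.measurable_prob _ _).aestronglyMeasurable
      (Eventually.of_forall fun x => ?_)
    rw [Real.norm_of_nonneg (M.prob_pos _ _ _).le, ← M.sum_prob x lam₀]
    exact Finset.single_le_sum (f := fun k => M.prob k x lam₀)
      (fun k _ => (M.prob_pos k x lam₀).le) (Finset.mem_univ _)
  have h := hp.sum_mul_integral_eq_zero hr hint fun x => by
    rw [← hlam₀]
    have h1 := sum_exp_mul_partialD_eq_zero
      (fun k => M.differentiable_logProb k x) (M.sum_exp_logProb x) s lam₀
    simp only [exp_logProb] at h1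
    simp only [← mul_assoc, ← Finset.sum_mul]
    rw [h1, zero_mul]
  rw [limitInfo_eq_sum_integral_mul hp hr hlam₀ hscore hhess]
  simp only [partialD_logProb_inr, mul_sub]
  have hsplit : ∀ k, ∫ x, (partialD (M.logProb k x) s lam₀ * (if k = l.succ then 1 else 0) -
      partialD (M.logProb k x) s lam₀ * M.prob l.succ x lam₀) ∂(M.condLaw νX p k) =
      (if k = l.succ then M.scoreMean νX p lam₀ k s else 0) -
      ∫ x, partialD (M.logProb k x) s lam₀ * M.prob l.succ x lam₀ ∂(M.condLaw νX p k) := by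
    intro k
    rw [integral_sub ((hsc k).mul_const _) (hint k)]
    split_ifs <;> simp [scoreMean]
  simp only [hsplit, mul_sub, Finset.sum_sub_distrib]
  rw [h]
  simp

theorem scoreCov_apply
    (hhess : ∀ k s t, Integrable (fun x => hessianMat (M.logProb k x) lam₀ s t) (M.condLaw νX p k))
    (s t : Fin S ⊕ Fin K) : M.scoreCov νX p r lam₀ s t = M.limitInfo νX p r lam₀ s t -
      ∑ k, r k * (M.scoreMean νX p lam₀ k s * M.scoreMean νX p lam₀ k t) := by
  have := hp.isProbabilityMeasure_condLaw
  rw [limitInfo_eq_sum_integral_mul hp hr hlam₀ hscore hhess, ← Finset.sum_sub_distrib]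
  simp only [scoreCov, Matrix.of_apply]
  refine Finset.sum_congr rfl fun k _ => ?_
  rw [covariance_eq_sub (hscore k s) (hscore k t), mul_sub]
  rfl

/-- The inverse information maps every mean score into the space of the nuisance parameters. -/
theorem inv_limitInfo_mulVec_scoreMean
    (hhess : ∀ k s t, Integrable (fun x => hessianMat (M.logProb k x) lam₀ s t) (M.condLaw νX p k))
    (hpos : (M.limitInfo νX p r lam₀).PosDef) (k : Fin (K + 1)) (s : Fin S) :
    ((M.limitInfo νX p r lam₀)⁻¹ *ᵥ M.scoreMean νX p lam₀ k) (Sum.inl s) = 0 := by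
  set I := M.limitInfo νX p r lam₀ with hI
  have hdet : IsUnit I.det := (Matrix.isUnit_iff_isUnit_det I).1 hpos.isUnit
  have hsucc : ∀ l : Fin K, (I⁻¹ *ᵥ M.scoreMean νX p lam₀ l.succ) (Sum.inl s) = 0 := by
    intro l
    have h1 : M.scoreMean νX p lam₀ l.succ = (r l.succ)⁻¹ • (I *ᵥ Pi.single (Sum.inr l) 1) := by
      ext t
      rw [Pi.smul_apply, Matrix.mulVec_single_one, Matrix.col_apply, hI,
        limitInfo_inr hp hr hlam₀ hscore hhess, smul_eq_mul, inv_mul_cancel_left₀ (hr _).ne']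
    rw [h1, Matrix.mulVec_smul, Matrix.mulVec_mulVec, Matrix.nonsing_inv_mul _ hdet,
      Matrix.one_mulVec]
    simp
  refine Fin.cases ?_ hsucc k
  have h0 : M.scoreMean νX p lam₀ 0 =
      -((r 0)⁻¹ • ∑ l : Fin K, r l.succ • M.scoreMean νX p lam₀ l.succ) := by
    ext t
    have h := sum_mul_scoreMean hp hr hlam₀ hscore t
    rw [Fin.sum_univ_succ] at h
    have h2 := (hr 0).ne'
    simp only [Pi.neg_apply, Pi.smul_apply, Finset.sum_apply, smul_eq_mul]
    field_simp
    linarith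
  rw [h0, Matrix.mulVec_neg, Matrix.mulVec_smul,
    show ∀ v : Fin K → Fin S ⊕ Fin K → ℝ, I⁻¹ *ᵥ ∑ l, v l = ∑ l, I⁻¹ *ᵥ v l from
      fun v => map_sum (Matrix.mulVecLin I⁻¹) v _]
  simp only [Matrix.mulVec_smul, Pi.neg_apply, Pi.smul_apply, Finset.sum_apply, hsucc,
    smul_zero, Finset.sum_const_zero, neg_zero]

/-- The sandwich covariance `Ī⁻¹ V Ī⁻¹` and the inverse information `Ī⁻¹` have the same
`θθ`-block, although `V` differs from `Ī`. -/
theorem toBlocks₁₁_sandwich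
    (hhess : ∀ k s t, Integrable (fun x => hessianMat (M.logProb k x) lam₀ s t) (M.condLaw νX p k))
    (hpos : (M.limitInfo νX p r lam₀).PosDef) :
    ((M.limitInfo νX p r lam₀)⁻¹ * M.scoreCov νX p r lam₀ *
      (M.limitInfo νX p r lam₀)⁻¹).toBlocks₁₁ = ((M.limitInfo νX p r lam₀)⁻¹).toBlocks₁₁ := by
  set I := M.limitInfo νX p r lam₀ with hI
  have hdet : IsUnit I.det := (Matrix.isUnit_iff_isUnit_det I).1 hpos.isUnit
  have hsymm : (I⁻¹)ᵀ = I⁻¹ := by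
    have h : (I⁻¹)ᴴ = I⁻¹ := hpos.inv.isHermitian
    rwa [Matrix.conjTranspose_eq_transpose_of_trivial] at h
  have hV : M.scoreCov νX p r lam₀ = I - ∑ k, r k •
      Matrix.vecMulVec (M.scoreMean νX p lam₀ k) (M.scoreMean νX p lam₀ k) := by
    ext s t
    rw [scoreCov_apply hp hr hlam₀ hscore hhess, Matrix.sub_apply, Matrix.sum_apply]
    rfl
  have hLVL : I⁻¹ * M.scoreCov νX p r lam₀ * I⁻¹ = I⁻¹ - ∑ k, r k •
      Matrix.vecMulVec (I⁻¹ *ᵥ M.scoreMean νX p lam₀ k) (I⁻¹ *ᵥ M.scoreMean νX p lam₀ k) := by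
    rw [hV, mul_sub, sub_mul, Matrix.nonsing_inv_mul _ hdet, one_mul, Finset.mul_sum,
      Finset.sum_mul]
    congr 1
    refine Finset.sum_congr rfl fun k _ => ?_
    rw [mul_smul_comm, smul_mul_assoc, Matrix.mul_vecMulVec, Matrix.vecMulVec_mul]
    conv_lhs => rw [← hsymm, Matrix.vecMul_transpose, hsymm]
  rw [hLVL]
  ext s t
  simp only [Matrix.toBlocks₁₁, Matrix.of_apply, Matrix.sub_apply, Matrix.sum_apply,
    Matrix.smul_apply, Matrix.vecMulVec_apply]
  have h0 := inv_limitInfo_mulVec_scoreMean hp hr hlam₀ hscore hhess hpos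
  rw [← hI] at h0
  simp [h0]

end Information

end AssociationModel

/-! ### A central limit theorem for stratified samples -/

section StratifiedCLT

variable {Ω : Type*} [MeasurableSpace Ω] {P : Measure Ω} [IsProbabilityMeasure P]

/-- The contribution of one stratum to the characteristic function of the normalized sum. -/
theorem tendsto_charFun_centered_pow {Y : ℕ → Ω → ℝ} (hY : MemLp (Y 0) 2 P)
    (hindep : iIndepFun Y P) (hident : ∀ i, IdentDistrib (Y i) (Y 0) P P) {r : ℝ} (hr : 0 < r)
    {N n : ℕ → ℕ} (hratio : ∀ m, (N m : ℝ) = r * n m) (hn : Tendsto n atTop atTop) :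
    Tendsto (fun m => charFun (P.map fun ω => Y 0 ω - P[Y 0]) ((√(n m : ℝ))⁻¹) ^ N m) atTop
      (𝓝 (Complex.exp ((-(r * Var[Y 0; P]) / 2 : ℝ)))) := by
  have hN : Tendsto N atTop atTop := by
    rw [← tendsto_natCast_atTop_iff (R := ℝ)]
    simp only [hratio]
    exact (tendsto_natCast_atTop_atTop.comp hn).const_mul_atTop hr
  set Z : ℕ → Ω → ℝ := fun i ω => Y i ω - P[Y 0] with hZ
  have hZindep : iIndepFun Z P := 
    hindep.comp (fun _ x => x - ∫ ω, Y 0 ω ∂P) fun _ => measurable_id.sub_const _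
  have hZident : ∀ i, IdentDistrib (Z i) (Z 0) P P := fun i =>
    (hident i).comp (u := fun x => x - ∫ ω, Y 0 ω ∂P) (measurable_id.sub_const _)
  have hlaw : HasLaw (id : ℝ → ℝ) (gaussianReal 0 Var[Y 0; P].toNNReal)
      (gaussianReal 0 Var[Y 0; P].toNNReal) := ⟨by fun_prop, Measure.map_id⟩
  -- as `N = r n`, the argument `1 / √n` is `√r / √N`
  have hclt := tendstoInDistribution_inv_sqrt_mul_sum_sub hlaw hY hindep hident
  have h1 := ProbabilityMeasure.tendsto_iff_tendsto_charFun.1 hclt.tendsto (√r)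
  have h2 := h1.comp hN
  have e1 : ∀ k : ℕ, (fun ω => (√(k : ℝ))⁻¹ * (∑ i ∈ Finset.range k, Y i ω - k * P[Y 0])) =
      fun ω => (√(k : ℝ))⁻¹ * ∑ i ∈ Finset.range k, Z i ω := by
    intro k
    funext ω
    simp [hZ, Finset.sum_sub_distrib]
  simp only [Function.comp_def, ProbabilityMeasure.coe_mk, e1,
    charFun_inv_sqrt_mul_sum hZindep hZident, Measure.map_id, charFun_gaussianReal] at h2
  refine (h2.congr fun m => ?_).trans_eq ?_
  · rw [hratio m, Real.sqrt_mul hr.le, mul_inv, mul_assoc, mul_comm (√(n m : ℝ))⁻¹, ← mul_assoc,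
      inv_mul_cancel₀ (Real.sqrt_pos.2 hr).ne', one_mul]
  · congr 2
    have hs : ((√r : ℝ) : ℂ) ^ 2 = (r : ℂ) := by
      rw [← Complex.ofReal_pow, Real.sq_sqrt hr.le]
    rw [hs, Real.coe_toNNReal _ (variance_nonneg _ _)]
    push_cast
    ring

variable {ι κ : Type*} [Fintype ι] [DecidableEq ι] [Fintype κ]

omit [IsProbabilityMeasure P] [DecidableEq ι] in
theorem variance_inner_eq_dotProduct [IsFiniteMeasure P] {Y : Ω → EuclideanSpace ℝ ι}
    (hY : ∀ s, MemLp (fun ω => Y ω s) 2 P) (t : ι → ℝ) :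
    Var[fun ω => ∑ s, t s * Y ω s; P] =
      t ⬝ᵥ (Matrix.of fun s s' => cov[fun ω => Y ω s, fun ω => Y ω s'; P]) *ᵥ t := by
  rw [← covariance_self, covariance_fun_sum_fun_sum (fun s => (hY s).const_mul _)
    (fun s => (hY s).const_mul _)]
  · simp only [dotProduct, Matrix.mulVec, Matrix.of_apply, Finset.mul_sum]
    refine Finset.sum_congr rfl fun s _ => Finset.sum_congr rfl fun s' _ => ?_
    rw [covariance_const_mul_left, covariance_const_mul_right]
    ring
  · exact (Finset.aemeasurable_fun_sum _ fun s _ =>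
      ((hY s).const_mul (t s)).aestronglyMeasurable.aemeasurable)

/-- The average, with weights `r k`, of the covariance matrices of the random vectors `Y k`. -/
def averageCov (P : Measure Ω) (r : κ → ℝ) (Y : κ → Ω → EuclideanSpace ℝ ι) : Matrix ι ι ℝ :=
  Matrix.of fun s t => ∑ k, r k * cov[fun ω => Y k ω s, fun ω => Y k ω t; P]

omit [DecidableEq ι] in
theorem dotProduct_averageCov_mulVec {r : κ → ℝ} {Y : κ → Ω → EuclideanSpace ℝ ι}
    (hY : ∀ k s, MemLp (fun ω => Y k ω s) 2 P) (t : ι → ℝ) :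
    t ⬝ᵥ averageCov P r Y *ᵥ t = ∑ k, r k * Var[fun ω => ∑ s, t s * Y k ω s; P] := by
  simp only [variance_inner_eq_dotProduct (hY _)]
  have h : averageCov P r Y = ∑ k, r k •
      (Matrix.of fun s s' => cov[fun ω => Y k ω s, fun ω => Y k ω s'; P]) := by
    ext s s'
    rw [Matrix.sum_apply]
    rfl
  rw [h, Matrix.sum_mulVec, dotProduct_sum]
  simp only [Matrix.smul_mulVec, dotProduct_smul, smul_eq_mul]

omit [DecidableEq ι] in
theorem posSemidef_averageCov {r : κ → ℝ} (hr : ∀ k, 0 < r k) {Y : κ → Ω → EuclideanSpace ℝ ι}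
    (hY : ∀ k s, MemLp (fun ω => Y k ω s) 2 P) : (averageCov P r Y).PosSemidef := by
  refine Matrix.PosSemidef.of_dotProduct_mulVec_nonneg ?_ fun t => ?_
  · refine Matrix.IsHermitian.ext fun s t => ?_
    simp only [averageCov, Matrix.of_apply, star_trivial]
    refine Finset.sum_congr rfl fun k _ => ?_
    rw [covariance_comm]
  · rw [star_trivial, dotProduct_averageCov_mulVec hY]
    exact Finset.sum_nonneg fun k _ => mul_nonneg (hr k).le (variance_nonneg _ _)

/-- Normalized centred sums over finitely many independent strata, with sizes in fixed ratios, are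
asymptotically normal. -/
theorem tendstoInDistribution_stratified_sum {Y : κ → ℕ → Ω → EuclideanSpace ℝ ι}
    (hmeas : ∀ k i, Measurable (Y k i)) (hY : ∀ k s, MemLp (fun ω => Y k 0 ω s) 2 P)
    (hindep : iIndepFun (fun j : κ × ℕ => Y j.1 j.2) P)
    (hident : ∀ k i, IdentDistrib (Y k i) (Y k 0) P P) {r : κ → ℝ} (hr : ∀ k, 0 < r k)
    {N : ℕ → κ → ℕ} {n : ℕ → ℕ} (hratio : ∀ m k, (N m k : ℝ) = r k * n m)
    (hn : Tendsto n atTop atTop) (c : κ → EuclideanSpace ℝ ι)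
    (hc : ∀ k s, c k s = ∫ ω, Y k 0 ω s ∂P) :
    TendstoInDistribution
      (fun m ω => (√(n m : ℝ))⁻¹ • ∑ k, ∑ i ∈ Finset.range (N m k), (Y k i ω - c k))
      atTop (id : EuclideanSpace ℝ ι → EuclideanSpace ℝ ι) (fun _ => P)
      (multivariateGaussian 0 (averageCov P r fun k => Y k 0)) where
  forall_aemeasurable m := by
    have : Measurable fun ω =>
        (√(n m : ℝ))⁻¹ • ∑ k, ∑ i ∈ Finset.range (N m k), (Y k i ω - c k) :=
      (Finset.measurable_fun_sum _ fun k _ => Finset.measurable_fun_sum _ fun i _ =>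
        (hmeas k i).sub_const _).fun_const_smul _
    exact this.aemeasurable
  aemeasurable_limit := aemeasurable_id
  tendsto := by
    refine ProbabilityMeasure.tendsto_iff_tendsto_charFun.2 fun t => ?_
    simp only [ProbabilityMeasure.coe_mk, Measure.map_id]
    -- the projections of the summands in the direction `t`
    set W : κ → ℕ → Ω → ℝ := fun k i ω => ∑ s, t s * Y k i ω s with hW
    have hg : Measurable fun y : EuclideanSpace ℝ ι => ∑ s, t s * y s := by fun_prop
    have hWmeas : ∀ k i, Measurable (W k i) := fun k i => hg.comp (hmeas k i)
    have hWindep : iIndepFun (fun j : κ × ℕ => W j.1 j.2) P :=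
      hindep.comp (fun _ y => ∑ s, t s * y s) fun _ => hg
    have hWident : ∀ k i, IdentDistrib (W k i) (W k 0) P P := fun k i => (hident k i).comp hg
    have hW2 : ∀ k, MemLp (W k 0) 2 P := fun k =>
      memLp_finsetSum _ fun s _ => (hY k s).const_mul (t s)
    have hmean : ∀ k, P[W k 0] = ∑ s, t s * c k s := by
      intro k
      simp only [hW]
      rw [integral_finsetSum _ fun s _ => ((hY k s).integrable (by norm_num)).const_mul (t s)]
      simp only [integral_const_mul, hc]
    have hfactor : ∀ m, charFun (P.map fun ω =>
        (√(n m : ℝ))⁻¹ • ∑ k, ∑ i ∈ Finset.range (N m k), (Y k i ω - c k)) t =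
        ∏ k, charFun (P.map fun ω => W k 0 ω - P[W k 0]) ((√(n m : ℝ))⁻¹) ^ N m k := by
      intro m
      set F : Finset (κ × ℕ) := (Finset.univ.sigma fun k => Finset.range (N m k)).map
        (Equiv.sigmaEquivProd κ ℕ).toEmbedding with hF
      have hmeasU : Measurable fun ω =>
          (√(n m : ℝ))⁻¹ • ∑ k, ∑ i ∈ Finset.range (N m k), (Y k i ω - c k) :=
        (Finset.measurable_fun_sum _ fun k _ => Finset.measurable_fun_sum _ fun i _ =>
          (hmeas k i).sub_const _).fun_const_smul _
      have hmeasV : Measurable fun ω => ∑ j ∈ F, (W j.1 j.2 ω - P[W j.1 0]) :=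
        Finset.measurable_fun_sum _ fun j _ => (hWmeas _ _).sub_const _
      have hinner : ∀ ω, inner ℝ
          ((√(n m : ℝ))⁻¹ • ∑ k, ∑ i ∈ Finset.range (N m k), (Y k i ω - c k)) t =
          inner ℝ (∑ j ∈ F, (W j.1 j.2 ω - P[W j.1 0])) ((√(n m : ℝ))⁻¹) := by
        intro ω
        have hterm : ∀ k i, inner ℝ (Y k i ω - c k) t = W k i ω - P[W k 0] := by
          intro k i
          rw [hmean, inner_sub_left]
          simp [PiLp.inner_apply, hW]
        rw [hF, Finset.sum_map, Finset.sum_sigma, inner_smul_left, sum_inner]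
        simp only [sum_inner, hterm]
        simp [← Finset.mul_sum, Finset.sum_sub_distrib]
      rw [charFun_apply, integral_map hmeasU.aemeasurable (by fun_prop)]
      simp only [hinner]
      rw [← integral_map (f := fun x : ℝ =>
          Complex.exp ((inner ℝ x (√(n m : ℝ))⁻¹ : ℝ) * Complex.I))
        hmeasV.aemeasurable (by fun_prop), ← charFun_apply]
      have hind : iIndepFun (fun (j : κ × ℕ) ω => W j.1 j.2 ω - P[W j.1 0]) P :=
        hWindep.comp (fun j x => x - ∫ ω, W j.1 0 ω ∂P) fun _ => measurable_id.sub_const _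
      rw [(hind.restrict F).charFun_map_fun_finsetSum_eq_prod
        fun j _ => ((hWmeas _ _).sub_const _).aemeasurable, hF, Finset.prod_map, Finset.prod_sigma]
      simp only [Finset.prod_apply]
      refine Finset.prod_congr rfl fun k _ => ?_
      rw [← Finset.card_range (N m k), ← Finset.prod_const, Finset.card_range]
      refine Finset.prod_congr rfl fun i _ => ?_
      have hid : IdentDistrib (fun ω => W k i ω - P[W k 0]) (fun ω => W k 0 ω - P[W k 0]) P P :=
        (hWident k i).comp (u := fun x => x - ∫ ω, W k 0 ω ∂P) (measurable_id.sub_const _)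
      exact congrFun (congrArg charFun hid.map_eq) _
    have hlim : charFun (multivariateGaussian 0 (averageCov P r fun k => Y k 0)) t =
        ∏ k, Complex.exp ((-(r k * Var[W k 0; P]) / 2 : ℝ)) := by
      rw [charFun_multivariateGaussian (posSemidef_averageCov hr hY),
        dotProduct_averageCov_mulVec hY, ← Complex.exp_sum]
      congr 1
      simp only [inner_zero_right, hW]
      push_cast
      rw [← Finset.sum_div, Finset.sum_neg_distrib]
      ring
    rw [hlim]
    simp only [hfactor]
    refine tendsto_finsetProd _ fun k _ => ?_
    exact tendsto_charFun_centered_pow (hW2 k)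
      (hWindep.precomp (g := fun i : ℕ => (k, i)) fun a b h => (Prod.ext_iff.1 h).2)
      (hWident k) (hr k) (fun m => hratio m k) hn

end StratifiedCLT

/-! ### Convergence in probability along a filter and Slutsky's theorem -/

section InProbability

variable {Ω : Type*} [MeasurableSpace Ω] {P : Measure Ω}

/-- The filter of the sets of pairs `(m, ω)` whose sections at `m` have probability tending to one.
Convergence in probability to a constant is convergence along this filter, so that the calculus of
limits along filters applies to it. -/
def inProb (P : Measure Ω) : Filter (ℕ × Ω) where
  sets := {B | Tendsto (fun m => P {ω | (m, ω) ∉ B}) atTop (𝓝 0)}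
  univ_sets := by simp
  sets_of_superset {A B} hA hAB := by
    refine tendsto_of_tendsto_of_tendsto_of_le_of_le tendsto_const_nhds hA (fun _ => zero_le) ?_
    exact fun m => measure_mono fun ω hω h => hω (hAB h)
  inter_sets {A B} hA hB := by
    have h := Tendsto.add (show Tendsto _ _ _ from hA) (show Tendsto _ _ _ from hB)
    rw [add_zero] at h
    refine tendsto_of_tendsto_of_tendsto_of_le_of_le tendsto_const_nhds h (fun _ => zero_le) ?_
    intro m
    refine (measure_mono fun ω hω => ?_).trans (measure_union_le _ _)
    simp only [Set.mem_ofPred_eq, Set.mem_inter_iff, not_and_or, Set.mem_union] at hω ⊢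
    exact hω

theorem mem_inProb {B : Set (ℕ × Ω)} :
    B ∈ inProb P ↔ Tendsto (fun m => P {ω | (m, ω) ∉ B}) atTop (𝓝 0) := Iff.rfl

theorem tendstoInMeasure_const_iff_inProb {E : Type*} [PseudoEMetricSpace E] {f : ℕ → Ω → E}
    {c : E} : TendstoInMeasure P f atTop (fun _ => c) ↔
      Tendsto (fun q : ℕ × Ω => f q.1 q.2) (inProb P) (𝓝 c) := by
  rw [Metric.nhds_basis_eball.tendsto_right_iff]
  refine forall₂_congr fun ε hε => ?_
  rw [Filter.Eventually, mem_inProb]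
  simp only [Metric.mem_eball, Set.mem_ofPred_eq, not_lt]

theorem tendsto_fst_inProb : Tendsto Prod.fst (inProb P) atTop := by
  intro B hB
  rw [Filter.mem_map, mem_inProb]
  refine tendsto_const_nhds.congr' ?_
  filter_upwards [hB] with m hm
  simp [hm]

variable [IsProbabilityMeasure P] {Ω' : Type*} [MeasurableSpace Ω'] {Q : Measure Ω'}
  [IsProbabilityMeasure Q]

/-- Sequences that agree with probability tending to one have the same limits in distribution. -/
theorem tendstoInDistribution_congr_inProb {E : Type*} [NormedAddCommGroup E]
    [SecondCountableTopology E] [MeasurableSpace E] [BorelSpace E] {X Y : ℕ → Ω → E} {Z : Ω' → E}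
    (h : TendstoInDistribution X atTop Z (fun _ => P) Q) (hY : ∀ m, AEMeasurable (Y m) P)
    (hXY : ∀ᶠ q in inProb P, X q.1 q.2 = Y q.1 q.2) :
    TendstoInDistribution Y atTop Z (fun _ => P) Q := by
  have h0 : TendstoInMeasure P (Y - X) atTop (fun _ => (0 : E)) := by
    refine tendstoInMeasure_const_iff_inProb.2 (tendsto_const_nhds.congr' ?_)
    filter_upwards [hXY] with q hq
    simp [hq]
  exact tendstoInDistribution_of_tendstoInMeasure_sub Y Z h h0 hY

variable {ι κ : Type*} [Fintype ι] [Fintype κ]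

/-- Slutsky's theorem for the product of a random matrix and a random vector. -/
theorem tendstoInDistribution_mulVec {W : ℕ → Ω → EuclideanSpace ℝ ι} {Z : Ω' → EuclideanSpace ℝ ι}
    (hW : TendstoInDistribution W atTop Z (fun _ => P) Q) {D : ℕ → Ω → Matrix κ ι ℝ}
    (hDmeas : ∀ m i j, Measurable fun ω => D m ω i j) {D₀ : Matrix κ ι ℝ}
    (hD : Tendsto (fun q : ℕ × Ω => D q.1 q.2) (inProb P) (𝓝 D₀)) :
    TendstoInDistribution (fun m ω => WithLp.toLp 2 (D m ω *ᵥ W m ω)) atTop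
      (fun ω => WithLp.toLp 2 (D₀ *ᵥ Z ω)) (fun _ => P) Q := by
  have hD' : TendstoInMeasure (E := κ → ι → ℝ) P D atTop (fun _ => D₀) :=
    tendstoInMeasure_const_iff_inProb.2 hD
  have hg : Continuous fun q : EuclideanSpace ℝ ι × (κ → ι → ℝ) =>
      (WithLp.toLp 2 (Matrix.of q.2 *ᵥ q.1) : EuclideanSpace ℝ κ) := by
    refine (PiLp.continuous_toLp 2 _).comp (continuous_pi fun i => ?_)
    simp only [Matrix.mulVec, dotProduct, Matrix.of_apply]
    fun_prop
  exact hW.continuous_comp_prodMk_of_tendstoInMeasure_const hg hD' fun m =>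
    (measurable_pi_iff.2 fun i => measurable_pi_iff.2 fun j => hDmeas m i j).aemeasurable

theorem map_mulVec_multivariateGaussian [DecidableEq ι] [DecidableEq κ]
    {V : Matrix ι ι ℝ} (hV : V.PosSemidef) (D : Matrix κ ι ℝ) (hD : (D * V * Dᵀ).PosSemidef) :
    (multivariateGaussian 0 V).map (fun z : EuclideanSpace ℝ ι => WithLp.toLp 2 (D *ᵥ z)) =
      multivariateGaussian 0 (D * V * Dᵀ) := by
  have hmeas : Measurable fun z : EuclideanSpace ℝ ι =>
      (WithLp.toLp 2 (D *ᵥ z) : EuclideanSpace ℝ κ) := by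
    refine (WithLp.measurable_toLp 2 _).comp (measurable_pi_iff.2 fun i => ?_)
    simp only [Matrix.mulVec, dotProduct]
    fun_prop
  have : IsProbabilityMeasure ((multivariateGaussian 0 V).map
      (fun z : EuclideanSpace ℝ ι => (WithLp.toLp 2 (D *ᵥ z) : EuclideanSpace ℝ κ))) :=
    Measure.isProbabilityMeasure_map hmeas.aemeasurable
  refine Measure.ext_of_charFun (funext fun t => ?_)
  have hinner : ∀ z : EuclideanSpace ℝ ι, inner ℝ (WithLp.toLp 2 (D *ᵥ z) : EuclideanSpace ℝ κ) t =
      inner ℝ z (WithLp.toLp 2 (Dᵀ *ᵥ t)) := by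
    intro z
    simp only [EuclideanSpace.inner_eq_star_dotProduct, star_trivial]
    rw [Matrix.dotProduct_mulVec, Matrix.mulVec_transpose]
  rw [charFun_apply, integral_map hmeas.aemeasurable (by fun_prop)]
  simp only [hinner]
  rw [← charFun_apply, charFun_multivariateGaussian hV, charFun_multivariateGaussian hD]
  congr 3
  · simp
  · rw [← Matrix.mulVec_mulVec, ← Matrix.mulVec_mulVec, Matrix.dotProduct_mulVec (t : κ → ℝ) D,
      Matrix.mulVec_transpose]

theorem measurable_matrix_inv_apply [DecidableEq ι] {A : Ω → Matrix ι ι ℝ}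
    (hA : ∀ i j, Measurable fun ω => A ω i j) (i j : ι) : Measurable fun ω => (A ω)⁻¹ i j := by
  let _ : MeasurableSpace (Matrix ι ι ℝ) := inferInstanceAs (MeasurableSpace (ι → ι → ℝ))
  have _ : BorelSpace (Matrix ι ι ℝ) := inferInstanceAs (BorelSpace (ι → ι → ℝ))
  have hA' : Measurable A :=
    measurable_pi_iff.2 fun i => measurable_pi_iff.2 fun j => hA i j
  have hdet : Measurable fun B : Matrix ι ι ℝ => B.det := continuous_id.matrix_det.measurable
  have hadj : Measurable fun B : Matrix ι ι ℝ => B.adjugate i j :=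
    (continuous_id.matrix_adjugate.matrix_elem i j).measurable
  simp only [Matrix.inv_def, Ring.inverse_eq_inv', Matrix.smul_apply, smul_eq_mul]
  exact (hdet.comp hA').inv.mul (hadj.comp hA')

end InProbability

/-! ### The estimated covariance matrix -/

section EstimatedCovariance

variable {S K : ℕ}

theorem isHermitian_estCov (J : Matrix (Fin S ⊕ Fin K) (Fin S ⊕ Fin K) ℝ) :
    (estCov J).IsHermitian :=
  (isHermitian_cfc _ J).submatrix Sum.inl

theorem estCov_eq_toBlocks₁₁_inv {J : Matrix (Fin S ⊕ Fin K) (Fin S ⊕ Fin K) ℝ} (hJ : J.PosDef) :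
    estCov J = (J⁻¹).toBlocks₁₁ := by
  rw [estCov, symPinv_eq_inv hJ.isHermitian hJ.isUnit]

theorem posDef_estCov {J : Matrix (Fin S ⊕ Fin K) (Fin S ⊕ Fin K) ℝ} (hJ : J.PosDef) :
    (estCov J).PosDef := by
  rw [estCov_eq_toBlocks₁₁_inv hJ]
  exact hJ.inv.submatrix Sum.inl_injective

theorem symPinv_symRoot_estCov_smul {J : Matrix (Fin S ⊕ Fin K) (Fin S ⊕ Fin K) ℝ}
    (hJ : J.IsHermitian) {c : ℝ} (hc : 0 ≤ c) :
    symPinv (symRoot (estCov (c • J))) = √c • symPinv (symRoot (estCov J)) := by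
  have h : estCov (c • J) = c⁻¹ • estCov J := by
    rw [estCov, symPinv_smul hJ]; rfl
  rw [h, symRoot_smul (isHermitian_estCov J) (inv_nonneg.2 hc), symPinv_smul (isHermitian_symRoot _),
    Real.sqrt_inv, inv_inv]

theorem continuousWithinAt_symPinv_symRoot_estCov
    {J : Matrix (Fin S ⊕ Fin K) (Fin S ⊕ Fin K) ℝ} (hJ : J.PosDef) :
    ContinuousWithinAt (fun B => symPinv (symRoot (estCov B))) {B | B.IsHermitian} J := by
  refine ContinuousWithinAt.comp (t := {B : Matrix (Fin S) (Fin S) ℝ | B.IsHermitian})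
    (g := fun B => symPinv (symRoot B)) (f := estCov)
    (continuousWithinAt_symPinv_symRoot (posDef_estCov hJ)) ?_ fun B _ => isHermitian_estCov B
  have hblock : Continuous fun B : Matrix (Fin S ⊕ Fin K) (Fin S ⊕ Fin K) ℝ => B.toBlocks₁₁ :=
    continuous_id.matrix_submatrix Sum.inl Sum.inl
  exact hblock.continuousAt.comp_continuousWithinAt
    (continuousWithinAt_symPinv hJ.isHermitian hJ.isUnit)

theorem measurable_symPinv_symRoot_estCov {Ω : Type*} [MeasurableSpace Ω]
    {J : Ω → Matrix (Fin S ⊕ Fin K) (Fin S ⊕ Fin K) ℝ}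
    (hJ : ∀ s t, Measurable fun ω => J ω s t) (i j : Fin S) :
    Measurable fun ω => symPinv (symRoot (estCov (J ω))) i j :=
  measurable_symPinv_apply (measurable_symRoot_apply fun _ _ => measurable_symPinv_apply hJ _ _) i j

end EstimatedCovariance

/-! ### Asymptotic normality of the estimator -/

namespace AssociationModel

variable {ΩX ΩY Ω : Type*} [MeasurableSpace ΩX] [MeasurableSpace ΩY] [MeasurableSpace Ω]
  {dX dY S K : ℕ} {M : AssociationModel ΩX ΩY dX dY S K}

theorem scoreVec_logLik (N : Fin (K + 1) → ℕ) (x : Fin (K + 1) → ℕ → ΩX) (u : Param S K) :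
    scoreVec (M.logLik N x) u =
      ∑ k, ∑ i ∈ Finset.range (N k), scoreVec (M.logProb k (x k i)) u := by
  ext s
  simp only [WithLp.ofLp_sum, Finset.sum_apply]
  exact M.partialD_logLik N x s u

theorem measurable_obsInfo (N : Fin (K + 1) → ℕ) {X : Fin (K + 1) → ℕ → Ω → ΩX}
    (hX : ∀ k i, Measurable (X k i)) {g : Ω → Param S K} (hg : Measurable g)
    (s t : Fin S ⊕ Fin K) :
    Measurable fun ω => M.obsInfo N (fun k i => X k i ω) (g ω) s t :=
  (measurable_hessianMat (f := fun ω => M.logLik N fun k i => X k i ω)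
    (M.measurable_logLik N hX) (fun ω => (M.contDiff_logLik N _).of_le (by norm_num)) hg s t).neg

theorem measurable_integral_obsInfo (N : Fin (K + 1) → ℕ) {X : Fin (K + 1) → ℕ → Ω → ΩX}
    (hX : ∀ k i, Measurable (X k i)) {g : Ω → Param S K} (hg : Measurable g) (u : Param S K)
    (s t : Fin S ⊕ Fin K) :
    Measurable fun ω => ∫ τ in (0 : ℝ)..1,
      M.obsInfo N (fun k i => X k i ω) (u + τ • (g ω - u)) s t := by
  simp only [intervalIntegral.integral_of_le zero_le_one]
  have h : Measurable fun q : Ω × ℝ =>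
      M.obsInfo N (fun k i => X k i q.1) (u + q.2 • (g q.1 - u)) s t :=
    measurable_obsInfo (X := fun k i (q : Ω × ℝ) => X k i q.1) N
      (fun k i => (hX k i).comp measurable_fst)
      (measurable_const.add (measurable_snd.smul ((hg.comp measurable_fst).sub_const u))) s t
  exact (h.stronglyMeasurable.integral_prod_right' (ν := volume.restrict (Set.Ioc 0 1))).measurable

/-- The mean value formula for the score of the log-likelihood. -/
theorem scoreVec_logLik_sub (N : Fin (K + 1) → ℕ) (x : Fin (K + 1) → ℕ → ΩX) (u v : Param S K)
    (t : Fin S ⊕ Fin K) :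
    scoreVec (M.logLik N x) u t - scoreVec (M.logLik N x) v t =
      ∑ s, (∫ τ in (0 : ℝ)..1, M.obsInfo N x (u + τ • (v - u)) s t) * (v - u) s := by
  have h := partialD_sub_eq_integral_hessianMat
    ((M.contDiff_logLik N x).of_le (by norm_num : (2 : WithTop ℕ∞) ≤ 3)) u v t
  simp only [obsInfo, Matrix.neg_apply, intervalIntegral.integral_neg, neg_mul,
    Finset.sum_neg_distrib]
  rw [← h, neg_sub]
  rfl

variable {νX : Measure ΩX} {νY : Measure ΩY} {p : ΩX → ΩY → ℝ} {θ₀ : EuclideanSpace ℝ (Fin S)}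
  {r : Fin (K + 1) → ℝ} {P : Measure Ω} [IsProbabilityMeasure P] {lam₀ : Param S K}
  {X : Fin (K + 1) → ℕ → Ω → ΩX}

omit [IsProbabilityMeasure P] in
theorem averageCov_scoreVec (hX : ∀ k i, Measurable (X k i))
    (hX_law : ∀ k i, P.map (X k i) = M.condLaw νX p k) :
    averageCov P r (fun k ω => scoreVec (M.logProb k (X k 0 ω)) lam₀) =
      M.scoreCov νX p r lam₀ := by
  have hm : ∀ k s, Measurable fun x => partialD (M.logProb k x) s lam₀ := fun k s =>
    measurable_partialD (M.measurable_logProb k)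
      (fun x => (M.contDiff_logProb k x).of_le (by norm_num)) s lam₀
  ext s t
  simp only [averageCov, scoreCov, Matrix.of_apply]
  refine Finset.sum_congr rfl fun k _ => ?_
  rw [← hX_law k 0, covariance_map (hm k s).aestronglyMeasurable (hm k t).aestronglyMeasurable
    (hX k 0).aemeasurable]
  rfl

omit [IsProbabilityMeasure P] in
theorem memLp_scoreVec (hX : ∀ k i, Measurable (X k i))
    (hX_law : ∀ k i, P.map (X k i) = M.condLaw νX p k)
    (hscore : ∀ k s, MemLp (fun x => partialD (M.logProb k x) s lam₀) 2 (M.condLaw νX p k))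
    (k : Fin (K + 1)) (s : Fin S ⊕ Fin K) :
    MemLp (fun ω => scoreVec (M.logProb k (X k 0 ω)) lam₀ s) 2 P := by
  have h := hscore k s
  rw [← hX_law k 0] at h
  exact h.comp_of_map (hX k 0).aemeasurable

/-- The normalized score at the true parameter is asymptotically normal. -/
theorem tendstoInDistribution_scoreVec (hp : M.IsJointDensity νX νY θ₀ p) (hr : ∀ k, 0 < r k)
    {N : ℕ → Fin (K + 1) → ℕ} {n : ℕ → ℕ} (hratio : ∀ m k, (N m k : ℝ) = r k * n m)
    (hn_top : Tendsto n atTop atTop) (hX : ∀ k i, Measurable (X k i))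
    (hX_law : ∀ k i, P.map (X k i) = M.condLaw νX p k)
    (hX_indep : iIndepFun (fun j : Fin (K + 1) × ℕ => X j.1 j.2) P)
    (hlam₀ : lam₀ = M.trueParam νX p r θ₀)
    (hscore : ∀ k s, MemLp (fun x => partialD (M.logProb k x) s lam₀) 2 (M.condLaw νX p k)) :
    TendstoInDistribution
      (fun m ω => (√(n m : ℝ))⁻¹ • scoreVec (M.logLik (N m) fun k i => X k i ω) lam₀)
      atTop (id : Param S K → Param S K) (fun _ => P)
      (multivariateGaussian 0 (M.scoreCov νX p r lam₀)) := by
  have hsm : ∀ k, Measurable fun x => scoreVec (M.logProb k x) lam₀ := fun k =>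
    measurable_scoreVec (M.measurable_logProb k)
      (fun x => (M.contDiff_logProb k x).of_le (by norm_num)) measurable_const
  have h := tendstoInDistribution_stratified_sum (P := P)
    (Y := fun k i ω => scoreVec (M.logProb k (X k i ω)) lam₀)
    (fun k i => (hsm k).comp (hX k i)) (memLp_scoreVec hX hX_law hscore)
    (hX_indep.comp (fun j x => scoreVec (M.logProb j.1 x) lam₀) fun j => hsm j.1)
    (fun k i => IdentDistrib.comp (u := fun x => scoreVec (M.logProb k x) lam₀)
      ⟨(hX k i).aemeasurable, (hX k 0).aemeasurable, by rw [hX_law, hX_law]⟩ (hsm k))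
    hr hratio hn_top (fun k => WithLp.toLp 2 (M.scoreMean νX p lam₀ k)) (fun k s => by
      change M.scoreMean νX p lam₀ k s = _
      rw [scoreMean, ← hX_law k 0, integral_map (hX k 0).aemeasurable]
      · rfl
      · exact (measurable_partialD (M.measurable_logProb k)
          (fun x => (M.contDiff_logProb k x).of_le (by norm_num)) s lam₀).aestronglyMeasurable)
  rw [averageCov_scoreVec hX hX_law] at h
  refine h.congr (fun m => Eventually.of_forall fun ω => ?_) (by rfl)
  -- the centring constants of the strata cancel, as their weighted average vanishes
  have hcancel : ∑ k, (N m k : ℝ) •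
      (WithLp.toLp 2 (M.scoreMean νX p lam₀ k) : Param S K) = 0 := by
    ext s
    have h0 := sum_mul_scoreMean hp hr hlam₀ hscore s
    simp only [WithLp.ofLp_sum, Finset.sum_apply, WithLp.ofLp_smul, Pi.smul_apply, hratio,
      smul_eq_mul]
    have : ∀ k, r k * (n m : ℝ) * M.scoreMean νX p lam₀ k s =
        (n m : ℝ) * (r k * M.scoreMean νX p lam₀ k s) := fun k => by ring
    simp only [this, ← Finset.mul_sum, h0]
    simp
  simp only [Finset.sum_sub_distrib, Finset.sum_const, Finset.card_range, scoreVec_logLik]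
  simp only [← Nat.cast_smul_eq_nsmul ℝ]
  rw [hcancel, sub_zero]

end AssociationModel

theorem tendsto_matrix {α ι κ : Type*} {l : Filter α} {A : α → Matrix ι κ ℝ} {A₀ : Matrix ι κ ℝ}
    (h : ∀ i j, Tendsto (fun a => A a i j) l (𝓝 (A₀ i j))) : Tendsto A l (𝓝 A₀) :=
  tendsto_pi_nhds.2 fun i => tendsto_pi_nhds.2 fun j => h i j

/-- The standardized limit is standard normal: with `Σ = [I⁻¹]_θθ` and `[I⁻¹ V I⁻¹]_θθ = Σ`, the
linear map `Σ^{-1/2} [I⁻¹]_θ·` carries the covariance `V` to the identity. -/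
theorem standardized_covariance_eq_one {S K : ℕ}
    {I V : Matrix (Fin S ⊕ Fin K) (Fin S ⊕ Fin K) ℝ} (hI : I.PosDef)
    (hV : (I⁻¹ * V * I⁻¹).toBlocks₁₁ = (I⁻¹).toBlocks₁₁) :
    symPinv (symRoot (estCov I)) * I⁻¹.submatrix Sum.inl id * V *
      (symPinv (symRoot (estCov I)) * I⁻¹.submatrix Sum.inl id)ᵀ = 1 := by
  have hC := posDef_estCov hI
  have hu := isUnit_symRoot hC
  have hd : IsUnit (symRoot (estCov I)).det := (Matrix.isUnit_iff_isUnit_det _).1 hu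
  have hmid : I⁻¹.submatrix Sum.inl id * V * (I⁻¹.submatrix Sum.inl id)ᵀ = estCov I := by
    have hsymm : (I⁻¹)ᵀ = I⁻¹ := by
      have h : (I⁻¹)ᴴ = I⁻¹ := hI.inv.isHermitian
      rwa [Matrix.conjTranspose_eq_transpose_of_trivial] at h
    rw [estCov_eq_toBlocks₁₁_inv hI, ← hV, Matrix.transpose_submatrix, hsymm]
    rfl
  have hsymm : (symPinv (symRoot (estCov I)))ᵀ = symPinv (symRoot (estCov I)) := by
    have h : (symPinv (symRoot (estCov I)))ᴴ = symPinv (symRoot (estCov I)) := isHermitian_cfc _ _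
    rwa [Matrix.conjTranspose_eq_transpose_of_trivial] at h
  rw [Matrix.transpose_mul, hsymm]
  calc _ = symPinv (symRoot (estCov I)) *
        (I⁻¹.submatrix Sum.inl id * V * (I⁻¹.submatrix Sum.inl id)ᵀ) *
          symPinv (symRoot (estCov I)) := by simp only [Matrix.mul_assoc]
    _ = 1 := by
      rw [hmid, symPinv_eq_inv (isHermitian_symRoot _) hu]
      conv_lhs => lhs; rhs; rw [← (symRoot_mul_self hC.posSemidef).2]
      rw [Matrix.nonsing_inv_mul_cancel_left _ _ hd, Matrix.mul_nonsing_inv _ hd]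

end

theorem mainTheorem6
    {ΩX ΩY Ω : Type*} [MeasurableSpace ΩX] [MeasurableSpace ΩY] [MeasurableSpace Ω]
    {dX dY S K : ℕ}
    -- the odds ratio model, the dominating measures and the joint distribution of (X, Y)
    (M : AssociationModel ΩX ΩY dX dY S K)
    (νX : Measure ΩX) [SigmaFinite νX] (νY : Measure ΩY) [SigmaFinite νY]
    (p : ΩX → ΩY → ℝ) (θ₀ : EuclideanSpace ℝ (Fin S))
    (hp : M.IsJointDensity νX νY θ₀ p)
    -- sample sizes tending to infinity with fixed positive ratios
    (r : Fin (K + 1) → ℝ) (hr : ∀ k, 0 < r k)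
    (N : ℕ → Fin (K + 1) → ℕ) (n : ℕ → ℕ) (hn : ∀ m, n m = ∑ k, N m k)
    (hratio : ∀ m k, (N m k : ℝ) = r k * n m)
    (hn_top : Tendsto n atTop atTop)
    -- independent observations from the conditional distributions of X given Y = y_k
    (P : Measure Ω) [IsProbabilityMeasure P]
    (X : Fin (K + 1) → ℕ → Ω → ΩX) (hX_meas : ∀ k i, Measurable (X k i))
    (hX_law : ∀ k i, P.map (X k i) = M.condLaw νX p k)
    (hX_indep : iIndepFun (fun j : Fin (K + 1) × ℕ => X j.1 j.2) P)
    -- the true parameter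
    (lam₀ : Param S K) (hlam₀ : lam₀ = M.trueParam νX p r θ₀)
    -- the moments defining the information matrix and the covariance of the score exist
    (hscore : ∀ k s, MemLp (fun x => partialD (M.logProb k x) s lam₀) 2 (M.condLaw νX p k))
    (hhess : ∀ k s t, Integrable (fun x => hessianMat (M.logProb k x) lam₀ s t)
      (M.condLaw νX p k))
    -- the information matrix is positive definite
    (hR2 : (M.limitInfo νX p r lam₀).PosDef)
    -- the estimators
    (lamHat : ℕ → Ω → Param S K) (hlamHat : ∀ m, Measurable (lamHat m))
    -- the estimating equation holds approximately
    (hN1 : TendstoInMeasure P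
      (fun m ω => (√(n m : ℝ))⁻¹ • scoreVec (M.logLik (N m) fun k i => X k i ω) (lamHat m ω))
      atTop (fun _ => 0))
    -- weak consistency
    (hN2 : TendstoInMeasure P lamHat atTop (fun _ => lam₀))
    -- consistency of the averaged information along the segment
    (hN3 : ∀ s t, TendstoInMeasure P
      (fun m ω => (n m : ℝ)⁻¹ * ∫ τ in (0 : ℝ)..1,
        M.obsInfo (N m) (fun k i => X k i ω) (lam₀ + τ • (lamHat m ω - lam₀)) s t)
      atTop (fun _ => M.limitInfo νX p r lam₀ s t))
    -- consistency of the observed information at the estimate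
    (hN4 : ∀ s t, TendstoInMeasure P
      (fun m ω => (n m : ℝ)⁻¹ * M.obsInfo (N m) (fun k i => X k i ω) (lamHat m ω) s t)
      atTop (fun _ => M.limitInfo νX p r lam₀ s t)) :
    TendstoInDistribution
      (fun m ω => Matrix.toEuclideanCLM (𝕜 := ℝ)
        (symPinv (symRoot (estCov (M.obsInfo (N m) (fun k i => X k i ω) (lamHat m ω)))))
        ((lamHat m ω).theta - θ₀))
      atTop (id : EuclideanSpace ℝ (Fin S) → EuclideanSpace ℝ (Fin S))
      (fun _ => P) (multivariateGaussian 0 (1 : Matrix (Fin S) (Fin S) ℝ)) ∧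
    ∀ m ω, estCov (M.obsInfo (N m) (fun k i => X k i ω) (lamHat m ω)) =
      estCov (M.obsInfoGivenX (N m) (fun k i => X k i ω) (lamHat m ω)) := by
  refine And.intro ?_ fun m ω =>
    congrArg estCov (M.obsInfoGivenX_eq_obsInfo (N m) (fun k i => X k i ω) (lamHat m ω)).symm
  set I := M.limitInfo νX p r lam₀ with hI
  set V := M.scoreCov νX p r lam₀ with hV
  have hθ : ∀ s, θ₀ s = lam₀ (Sum.inl s) := fun s => by rw [hlam₀]; rfl
  have hdet : IsUnit I.det := (Matrix.isUnit_iff_isUnit_det I).1 hR2.isUnit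
  -- the normalized observed information, at the estimate and averaged over the segment
  let J : ℕ → Ω → Matrix (Fin S ⊕ Fin K) (Fin S ⊕ Fin K) ℝ := fun m ω =>
    (n m : ℝ)⁻¹ • M.obsInfo (N m) (fun k i => X k i ω) (lamHat m ω)
  let B : ℕ → Ω → Matrix (Fin S ⊕ Fin K) (Fin S ⊕ Fin K) ℝ := fun m ω => Matrix.of fun t s =>
    (n m : ℝ)⁻¹ * ∫ τ in (0 : ℝ)..1,
      M.obsInfo (N m) (fun k i => X k i ω) (lam₀ + τ • (lamHat m ω - lam₀)) s t
  have hJmeas : ∀ m s t, Measurable fun ω => J m ω s t := fun m s t => by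
    simp only [J, Matrix.smul_apply, smul_eq_mul]
    exact (M.measurable_obsInfo (N m) hX_meas (hlamHat m) s t).const_mul _
  have hBmeas : ∀ m s t, Measurable fun ω => B m ω s t := fun m s t => by
    simp only [B, Matrix.of_apply]
    exact (M.measurable_integral_obsInfo (N m) hX_meas (hlamHat m) lam₀ t s).const_mul _
  have hJlim : Tendsto (fun q : ℕ × Ω => J q.1 q.2) (inProb P) (𝓝 I) := by
    refine tendsto_matrix fun s t => ?_
    have h := tendstoInMeasure_const_iff_inProb.1 (hN4 s t)
    simp only [J, Matrix.smul_apply, smul_eq_mul]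
    exact h
  have hBlim : Tendsto (fun q : ℕ × Ω => B q.1 q.2) (inProb P) (𝓝 I) := by
    -- `B` is indexed as in the mean value formula, so that its limit is the transpose of `I`
    refine tendsto_matrix fun s t => ?_
    have h := tendstoInMeasure_const_iff_inProb.1 (hN3 t s)
    rw [← hR2.isHermitian.apply t s, star_trivial] at h
    simp only [B, Matrix.of_apply]
    exact h
  have hJherm : ∀ m ω, (J m ω).IsHermitian := fun m ω => by
    have h : (M.obsInfo (N m) (fun k i => X k i ω) (lamHat m ω))ᴴ = _ :=
      M.isHermitian_obsInfo (N m) _ _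
    rw [Matrix.IsHermitian, Matrix.conjTranspose_smul, h, star_trivial]
  -- the random matrix carrying the normalized score difference to the standardized estimator
  let C : ℕ → Ω → Matrix (Fin S) (Fin S) ℝ := fun m ω => symPinv (symRoot (estCov (J m ω)))
  let D : ℕ → Ω → Matrix (Fin S) (Fin S ⊕ Fin K) ℝ := fun m ω =>
    C m ω * (B m ω)⁻¹.submatrix Sum.inl id
  let D₀ : Matrix (Fin S) (Fin S ⊕ Fin K) ℝ :=
    symPinv (symRoot (estCov I)) * I⁻¹.submatrix Sum.inl id
  have hCmeas : ∀ m i j, Measurable fun ω => C m ω i j := fun m =>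
    measurable_symPinv_symRoot_estCov (hJmeas m)
  have hDmeas : ∀ m i j, Measurable fun ω => D m ω i j := fun m i j => by
    simp only [D, Matrix.mul_apply, Matrix.submatrix_apply]
    exact Finset.measurable_fun_sum _ fun a _ =>
      (hCmeas m i a).mul (measurable_matrix_inv_apply (hBmeas m) _ _)
  have hDlim : Tendsto (fun q : ℕ × Ω => D q.1 q.2) (inProb P) (𝓝 D₀) := by
    have h1 : Tendsto (fun q : ℕ × Ω => C q.1 q.2) (inProb P)
        (𝓝 (symPinv (symRoot (estCov I)))) :=
      (continuousWithinAt_symPinv_symRoot_estCov hR2).tendsto.comp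
        (tendsto_nhdsWithin_iff.2 ⟨hJlim, Eventually.of_forall fun q => hJherm q.1 q.2⟩)
    have h2 : Tendsto (fun q : ℕ × Ω => (B q.1 q.2)⁻¹) (inProb P) (𝓝 I⁻¹) :=
      (continuousAt_matrix_inv I (NormedRing.inverse_continuousAt hdet.unit)).tendsto.comp hBlim
    have h3 : Continuous fun q : Matrix (Fin S) (Fin S) ℝ ×
        Matrix (Fin S ⊕ Fin K) (Fin S ⊕ Fin K) ℝ => q.1 * q.2.submatrix Sum.inl id :=
      continuous_fst.matrix_mul (continuous_snd.matrix_submatrix _ _)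
    exact (h3.tendsto (symPinv (symRoot (estCov I)), I⁻¹)).comp (h1.prodMk_nhds h2)
  -- the normalized difference of the scores at the true parameter and at the estimate
  let W : ℕ → Ω → Param S K := fun m ω =>
    (√(n m : ℝ))⁻¹ • scoreVec (M.logLik (N m) fun k i => X k i ω) lam₀ +
      -((√(n m : ℝ))⁻¹ • scoreVec (M.logLik (N m) fun k i => X k i ω) (lamHat m ω))
  have hW : TendstoInDistribution W atTop (id : Param S K → Param S K) (fun _ => P)
      (multivariateGaussian 0 V) := by
    have h1 := AssociationModel.tendstoInDistribution_scoreVec hp hr hratio hn_top hX_meas hX_law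
      hX_indep hlam₀ hscore
    have h2 : TendstoInMeasure P (fun m ω => -((√(n m : ℝ))⁻¹ •
        scoreVec (M.logLik (N m) fun k i => X k i ω) (lamHat m ω))) atTop
        (fun _ => (0 : Param S K)) := by
      have h := (tendstoInMeasure_const_iff_inProb.1 hN1).neg
      rw [neg_zero] at h
      exact tendstoInMeasure_const_iff_inProb.2 h
    have h3 : ∀ m, AEMeasurable (fun ω => -((√(n m : ℝ))⁻¹ •
        scoreVec (M.logLik (N m) fun k i => X k i ω) (lamHat m ω))) P := fun m =>
      ((measurable_scoreVec (M.measurable_logLik (N m) hX_meas)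
        (fun ω => (M.contDiff_logLik (N m) _).of_le (by norm_num))
        (hlamHat m)).fun_const_smul _).fun_neg.aemeasurable
    exact (h1.add_of_tendstoInMeasure_const h2 h3).congr (fun m => by rfl)
      (Eventually.of_forall fun z => add_zero z)
  have hWB : ∀ m ω, 0 < n m →
      W m ω = WithLp.toLp 2 (√(n m : ℝ) • (B m ω *ᵥ (lamHat m ω - lam₀))) := by
    intro m ω hm
    have hm' : (0 : ℝ) < n m := by exact_mod_cast hm
    ext t
    have h := M.scoreVec_logLik_sub (N m) (fun k i => X k i ω) lam₀ (lamHat m ω) t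
    have e : W m ω t = (√(n m : ℝ))⁻¹ *
        (scoreVec (M.logLik (N m) fun k i => X k i ω) lam₀ t -
          scoreVec (M.logLik (N m) fun k i => X k i ω) (lamHat m ω) t) := by
      simp only [W, PiLp.add_apply, PiLp.neg_apply, PiLp.smul_apply, smul_eq_mul]
      ring
    have hsq : (√(n m : ℝ))⁻¹ = √(n m : ℝ) * (n m : ℝ)⁻¹ := by
      rw [← div_eq_mul_inv, Real.sqrt_div_self', one_div]
    rw [e, h, hsq]
    simp only [B, Pi.smul_apply, Matrix.mulVec, dotProduct, Matrix.of_apply, smul_eq_mul,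
      mul_assoc, Finset.mul_sum]
    rfl
  -- the standardized estimator
  have hTmeas : ∀ m, AEMeasurable (fun ω => Matrix.toEuclideanCLM (𝕜 := ℝ)
      (symPinv (symRoot (estCov (M.obsInfo (N m) (fun k i => X k i ω) (lamHat m ω)))))
      ((lamHat m ω).theta - θ₀)) P := by
    intro m
    refine Measurable.aemeasurable ((WithLp.measurable_toLp 2 _).comp
      (measurable_pi_iff.2 fun i => ?_))
    change Measurable fun ω => ∑ j,
      symPinv (symRoot (estCov (M.obsInfo (N m) (fun k i => X k i ω) (lamHat m ω)))) i j *
        (lamHat m ω (Sum.inl j) - θ₀ j)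
    refine Finset.measurable_fun_sum _ fun j _ => ?_
    refine (measurable_symPinv_symRoot_estCov
      (M.measurable_obsInfo (N m) hX_meas (hlamHat m)) i j).mul ?_
    have : Measurable fun ω => lamHat m ω (Sum.inl j) := by
      have := hlamHat m
      fun_prop
    exact this.sub_const (θ₀ j)
  have hTD : ∀ᶠ q in inProb P, WithLp.toLp 2 (D q.1 q.2 *ᵥ W q.1 q.2) =
      Matrix.toEuclideanCLM (𝕜 := ℝ) (symPinv (symRoot (estCov
        (M.obsInfo (N q.1) (fun k i => X k i q.2) (lamHat q.1 q.2)))))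
        ((lamHat q.1 q.2).theta - θ₀) := by
    have hunit : ∀ᶠ q in inProb P, (B q.1 q.2).det ≠ 0 :=
      ((Continuous.matrix_det continuous_id).tendsto I).comp hBlim |>.eventually_ne hdet.ne_zero
    have hnpos : ∀ᶠ q in inProb P, 0 < n q.1 :=
      tendsto_fst_inProb.eventually (hn_top.eventually_gt_atTop 0)
    filter_upwards [hunit, hnpos] with ⟨m, ω⟩ hq1 hq2
    have hm' : (0 : ℝ) < n m := by exact_mod_cast hq2
    have hobs : M.obsInfo (N m) (fun k i => X k i ω) (lamHat m ω) = (n m : ℝ) • J m ω := by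
      simp only [J]
      rw [smul_smul, mul_inv_cancel₀ hm'.ne', one_smul]
    have hBW : (B m ω)⁻¹ *ᵥ W m ω = √(n m : ℝ) • (lamHat m ω - lam₀ : Param S K) := by
      rw [hWB m ω hq2]
      simp only [Matrix.mulVec_smul, Matrix.mulVec_mulVec]
      rw [Matrix.nonsing_inv_mul _ hq1.isUnit, Matrix.one_mulVec]
      rfl
    rw [hobs, symPinv_symRoot_estCov_smul (hJherm m ω) hm'.le]
    ext i
    have h1 : (D m ω *ᵥ W m ω) i = (C m ω *ᵥ fun j => ((B m ω)⁻¹ *ᵥ W m ω) (Sum.inl j)) i := by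
      simp only [D, ← Matrix.mulVec_mulVec]
      rfl
    have h2 : Matrix.toEuclideanCLM (𝕜 := ℝ) (√(n m : ℝ) • C m ω) ((lamHat m ω).theta - θ₀) i =
        ((√(n m : ℝ) • C m ω) *ᵥ fun j => lamHat m ω (Sum.inl j) - θ₀ j) i := rfl
    change (D m ω *ᵥ W m ω) i = _
    rw [h1, h2, hBW]
    simp only [Matrix.mulVec, dotProduct, Matrix.smul_apply, smul_eq_mul, Pi.smul_apply,
      WithLp.ofLp_sub, Pi.sub_apply, hθ]
    exact Finset.sum_congr rfl fun j _ => by ring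
  have hlim := tendstoInDistribution_congr_inProb (tendstoInDistribution_mulVec hW hDmeas hDlim)
    hTmeas hTD
  -- the limit law is the standard normal distribution
  have hVpsd : V.PosSemidef := by
    rw [hV, ← AssociationModel.averageCov_scoreVec hX_meas hX_law]
    exact posSemidef_averageCov hr (AssociationModel.memLp_scoreVec hX_meas hX_law hscore)
  have hone : D₀ * V * D₀ᵀ = 1 := standardized_covariance_eq_one hR2
    (AssociationModel.toBlocks₁₁_sandwich hp hr hlam₀ hscore hhess hR2)
  have hmap := map_mulVec_multivariateGaussian hVpsd D₀ (by rw [hone]; exact .one)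
  rw [hone] at hmap
  refine ⟨hTmeas, aemeasurable_id, ?_⟩
  refine hlim.tendsto.trans_eq ?_
  congr 1
  exact Subtype.ext (hmap.trans Measure.map_id.symm)
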